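/- Let $F$ be a subfield of $\mathbb R$. For $S\subseteq F[x]$ put $K_S=\{x\in\mathbb R: g(x)\ge 0 \text{ for all } g\in S\}$, and let $T_S\subseteq F[x]$ be the preordering generated by $S$, i.e. the set of all finite sums of terms $a\,q^2\prod_{g\in E}g$ with $a\in F$, $a\ge 0$, $q\in F[x]$ and $E\subseteq S$ finite. For $K\subseteq\mathbb R$ put $Pos(K)=\{f\in F[x]: f\ge 0\text{ on }K\}$; $Pos(K)$ is called finitely generated if $Pos(K)=T_S$ for some finite $S\subset F[x]$. A set $K_S$ with $S\subset F[x]$ finite is called basic closed semi-algebraic. If $K\ne\mathbb R$ is a non-empty finite union of closed intervals (points and unbounded closed intervals allowed) with $\partial K\subset F$, the natural choice of generators $\mathcal N$ of $K$ consists of: $x-a$ for $a\in\partial K$ with $(-\infty,a)\cap K=\emptyset$; $a-x$ for $a\in\partial K$ with $(a,\infty)\cap K=\emptyset$; and $(x-a)(x-b)$ for $a<b$ in $\partial K$ with $(a,b)\cap K=\emptyset$. (For $K=\mathbb R$, $\mathcal N=\{1\}$.) **Theorem 7.3.** Let $K\subset\mathbb R$ and $K_n$ $(n\ge 0)$ be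 as in one of the following cases, where $\alpha_i,\beta_i\in F$ and $\alpha_i\le\beta_i<\alpha_{i+1}$ for all indices occurring. 1. $K=\bigcup_{i\ge 0}[\alpha_i,\beta_i]$ with $\lim_{i\to\infty}\alpha_i=\lim_{i\to\infty}\beta_i=\infty$, and $K_n=\bigcup_{i=0}^n[\alpha_i,\beta_i]\cup[\alpha_{n+1},\infty)$. Here $[\alpha_0,\beta_0]$ may be replaced throughout by $(-\infty,\beta_0]$. 2. $K=\bigcup_{i\le 0}[\alpha_i,\beta_i]$ with $\lim_{i\to-\infty}\alpha_i=\lim_{i\to-\infty}\beta_i=-\infty$, and $K_n=\bigcup_{i=-n}^0[\alpha_i,\beta_i]\cup(-\infty,\beta_{-(n+1)}]$. Here $[\alpha_0,\beta_0]$ may be replaced throughout by $[\alpha_0,\infty)$. 3. $K=\bigcup_{i\in\mathbb Z}[\alpha_i,\beta_i]$ with $\lim_{i\to\pm\infty}\alpha_i=\lim_{i\to\pm\infty}\beta_i=\pm\infty$, and $K_n=\bigcup_{i=-n}^n[\alpha_i,\beta_i]\cup(-\infty,\beta_{-(n+1)}]\cup[\alpha_{n+1},\infty)$. 4. $K=\{0\}\cup\{\tfrac1i: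 i\ge 1\}$ and $K_n=[0,\tfrac1{n+1}]\cup\{\tfrac1i: 1\le i\le n\}$. Let $\mathcal N_n$ be the natural choice of generators of $K_n$. Then each $\mathcal N_n$ is finite and $K_n=K_{\mathcal N_n}$ (so $K_n$ is a basic closed semi-algebraic set), and $$Pos(K)=\bigcup_{n\ge 0}Pos(K_n)=\bigcup_{n\ge 0}T_{\mathcal N_n}.$$ Moreover, $K$ is not a semi-algebraic subset of $\mathbb R$, and $Pos(K)$ is not a finitely generated preordering of $F[x]$. -/

import Mathlib

open Polynomial Set Filter

/-- The basic closed set of a set `S` of polynomials over `F`: the real points at which every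
member of `S` is nonnegative. -/
def basicClosedSet (F : Subfield ℝ) (S : Set (Polynomial F)) : Set ℝ :=
  {x | ∀ g ∈ S, 0 ≤ aeval x g}

/-- The polynomials with coefficients in `F` that are nonnegative on `K`. -/
def posPoly (F : Subfield ℝ) (K : Set ℝ) : Set (Polynomial F) :=
  {f | ∀ x ∈ K, 0 ≤ aeval x f}

/-- The preordering generated by `S`: all finite sums of terms `a * q ^ 2 * g ^ e`, where `a` is a
nonnegative element of `F`, `q` is a polynomial over `F`, and `g ^ e` is a product of
finitely many distinct members of `S` (the empty product being `1`). -/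
def genPreordering (F : Subfield ℝ) (S : Set (Polynomial F)) : Set (Polynomial F) :=
  (AddSubmonoid.closure {p : Polynomial F | ∃ (a : F) (q : Polynomial F)
      (e : Finset (Polynomial F)), 0 ≤ (a : ℝ) ∧ (e : Set (Polynomial F)) ⊆ S ∧
        p = C a * q ^ 2 * ∏ g ∈ e, g} : AddSubmonoid (Polynomial F))

/-- `P` is a finitely generated preordering of `F[x]`. -/
def IsFinitelyGeneratedPreordering (F : Subfield ℝ) (P : Set (Polynomial F)) : Prop :=
  ∃ S : Finset (Polynomial F), P = genPreordering F (S : Set (Polynomial F))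

/-- The natural choice of generators of a (nonempty) finite union `K` of closed intervals with
boundary points in `F`. -/
def naturalGenerators (F : Subfield ℝ) (K : Set ℝ) : Set (Polynomial F) :=
  {g | (K = univ ∧ g = 1) ∨
    (∃ a : F, (a : ℝ) ∈ frontier K ∧ Iio (a : ℝ) ∩ K = ∅ ∧ g = X - C a) ∨
    (∃ a : F, (a : ℝ) ∈ frontier K ∧ Ioi (a : ℝ) ∩ K = ∅ ∧ g = C a - X) ∨
    (∃ a b : F, (a : ℝ) ∈ frontier K ∧ (b : ℝ) ∈ frontier K ∧ (a : ℝ) < b ∧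
      Ioo (a : ℝ) b ∩ K = ∅ ∧ g = (X - C a) * (X - C b))}

/-- Semialgebraic subsets of the real line: the smallest family of sets that contains
all sets `{x | 0 < p x}`, with `p` a real polynomial, and is closed under complements
and finite unions (hence finite intersections). -/
inductive IsSemialgebraicSet : Set ℝ → Prop
  | pos (p : Polynomial ℝ) : IsSemialgebraicSet {x | 0 < p.eval x}
  | compl (A : Set ℝ) : IsSemialgebraicSet A → IsSemialgebraicSet Aᶜ
  | union (A B : Set ℝ) : IsSemialgebraicSet A → IsSemialgebraicSet B →
      IsSemialgebraicSet (A ∪ B)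

/-- `ApproximatedSet F K L` says that `K` is one of the sets under consideration and that
`L 0, L 1, L 2, …` is its sequence of approximations. -/
inductive ApproximatedSet (F : Subfield ℝ) : Set ℝ → (ℕ → Set ℝ) → Prop
  /-- Intervals indexed by `i ≥ 0`, going to `+∞`. -/
  | right (α β : ℕ → F)
      (hle : ∀ i, (α i : ℝ) ≤ β i) (hlt : ∀ i, (β i : ℝ) < α (i + 1))
      (hα : Tendsto (fun i => (α i : ℝ)) atTop atTop)
      (hβ : Tendsto (fun i => (β i : ℝ)) atTop atTop) :
      ApproximatedSet F
        (⋃ i : ℕ, Icc (α i : ℝ) (β i))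
        (fun n => (⋃ i : ℕ, ⋃ _ : i ≤ n, Icc (α i : ℝ) (β i)) ∪ Ici (α (n + 1) : ℝ))
  /-- The same, with the interval of index `0` replaced by `(-∞, β 0]`
  (the value `α 0` plays no role). -/
  | rightUnbounded (α β : ℕ → F)
      (hle : ∀ i, 1 ≤ i → (α i : ℝ) ≤ β i) (hlt : ∀ i, (β i : ℝ) < α (i + 1))
      (hα : Tendsto (fun i => (α i : ℝ)) atTop atTop)
      (hβ : Tendsto (fun i => (β i : ℝ)) atTop atTop) :
      ApproximatedSet F
        (Iic (β 0 : ℝ) ∪ ⋃ i : ℕ, ⋃ _ : 1 ≤ i, Icc (α i : ℝ) (β i))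
        (fun n => Iic (β 0 : ℝ) ∪ (⋃ i : ℕ, ⋃ _ : 1 ≤ i ∧ i ≤ n, Icc (α i : ℝ) (β i)) ∪
          Ici (α (n + 1) : ℝ))
  /-- Intervals indexed by `i ≤ 0`, going to `-∞` (values at `i > 0` play no role). -/
  | left (α β : ℤ → F)
      (hle : ∀ i, i ≤ 0 → (α i : ℝ) ≤ β i) (hlt : ∀ i, i < 0 → (β i : ℝ) < α (i + 1))
      (hα : Tendsto (fun i => (α i : ℝ)) atBot atBot)
      (hβ : Tendsto (fun i => (β i : ℝ)) atBot atBot) :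
      ApproximatedSet F
        (⋃ i : ℤ, ⋃ _ : i ≤ 0, Icc (α i : ℝ) (β i))
        (fun n => (⋃ i : ℤ, ⋃ _ : -(n : ℤ) ≤ i ∧ i ≤ 0, Icc (α i : ℝ) (β i)) ∪
          Iic (β (-((n : ℤ) + 1)) : ℝ))
  /-- The same, with the interval of index `0` replaced by `[α 0, ∞)`
  (the value `β 0` plays no role). -/
  | leftUnbounded (α β : ℤ → F)
      (hle : ∀ i, i < 0 → (α i : ℝ) ≤ β i) (hlt : ∀ i, i < 0 → (β i : ℝ) < α (i + 1))
      (hα : Tendsto (fun i => (α i : ℝ)) atBot atBot)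
      (hβ : Tendsto (fun i => (β i : ℝ)) atBot atBot) :
      ApproximatedSet F
        ((⋃ i : ℤ, ⋃ _ : i < 0, Icc (α i : ℝ) (β i)) ∪ Ici (α 0 : ℝ))
        (fun n => Iic (β (-((n : ℤ) + 1)) : ℝ) ∪
          (⋃ i : ℤ, ⋃ _ : -(n : ℤ) ≤ i ∧ i < 0, Icc (α i : ℝ) (β i)) ∪ Ici (α 0 : ℝ))
  /-- Intervals indexed by all integers, going to `±∞`. -/
  | twoSided (α β : ℤ → F)
      (hle : ∀ i, (α i : ℝ) ≤ β i) (hlt : ∀ i, (β i : ℝ) < α (i + 1))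
      (hαr : Tendsto (fun i => (α i : ℝ)) atTop atTop)
      (hβr : Tendsto (fun i => (β i : ℝ)) atTop atTop)
      (hαl : Tendsto (fun i => (α i : ℝ)) atBot atBot)
      (hβl : Tendsto (fun i => (β i : ℝ)) atBot atBot) :
      ApproximatedSet F
        (⋃ i : ℤ, Icc (α i : ℝ) (β i))
        (fun n => (⋃ i : ℤ, ⋃ _ : -(n : ℤ) ≤ i ∧ i ≤ (n : ℤ), Icc (α i : ℝ) (β i)) ∪
          Iic (β (-((n : ℤ) + 1)) : ℝ) ∪ Ici (α ((n : ℤ) + 1) : ℝ))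
  /-- The point `0` together with the reciprocals of the positive integers. -/
  | reciprocals :
      ApproximatedSet F
        ({0} ∪ {x : ℝ | ∃ i : ℕ, 1 ≤ i ∧ x = 1 / (i : ℝ)})
        (fun n => Icc (0 : ℝ) (1 / ((n : ℝ) + 1)) ∪
          {x : ℝ | ∃ i : ℕ, 1 ≤ i ∧ i ≤ n ∧ x = 1 / (i : ℝ)})

/-! Near an end of the line, or just to the right of `0`, a real polynomial has a definite sign. The
set `K` keeps recurring at such places, and the n-th approximation exceeds `K` only inside
neighbourhoods of them that shrink with n. So a polynomial nonnegative on `K` is nonnegative on some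
approximation (`IsTameApproximation.posPoly_eq`). The complement of `K` recurs there too, which
rules out semialgebraicity. A finite generating set would lie in the positive polynomials of a
single approximation; but the natural generators of the next one are nonnegative on `K` and cut out
a strictly smaller set.

The substance is saturation, `genPreordering_naturalGenerators`: for a nonempty closed `M` with
boundary in `F`, the natural generators generate all of `posPoly F M`. Over the reals one splits off
a factor for each sign change in a gap, and a square or a square plus a constant otherwise. Over `F`
the roots involved need not be available, and three devices replace them. A zero on `M` outside `F`
is interior to `M`, so the square of its minimal polynomial splits off
(`exists_sq_factor_of_root_notMem`). What remains is `Z * h`, with `Z` a product of linear factors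
over `F` and `h` without zeros on `M`. If `q` is a real polynomial close to `h`, of no larger
degree, then `Z * q` is still nonnegative on `M`. Moving the data of its real factorization into
`F`, while fixing the roots already in `F`, gives members of the preordering that converge to `Z *
q` and are divisible by `Z` (`exists_rootApprox_mem_genPreordering`). Hence the polynomials `k` over
`F` with `Z * k` in the preordering accumulate at every point near `h`, so `h` lies in their real
convex hull, and the convex combination can be taken over `F`
(`exists_convex_combination_over_subfield`). -/

/-! ### Preorderings over a subfield. -/

section Preordering

variable {F : Subfield ℝ} {S : Set (Polynomial F)}

theorem add_mem_genPreordering {p q : Polynomial F} (hp : p ∈ genPreordering F S)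
    (hq : q ∈ genPreordering F S) : p + q ∈ genPreordering F S :=
  AddSubmonoid.add_mem _ hp hq

theorem zero_mem_genPreordering : (0 : Polynomial F) ∈ genPreordering F S :=
  AddSubmonoid.zero_mem _

theorem sum_mem_genPreordering {ι : Type*} {s : Finset ι} {p : ι → Polynomial F}
    (h : ∀ i ∈ s, p i ∈ genPreordering F S) : ∑ i ∈ s, p i ∈ genPreordering F S :=
  AddSubmonoid.sum_mem _ h

theorem term_mem_genPreordering {a : F} (q : Polynomial F) {e : Finset (Polynomial F)}
    (ha : 0 ≤ (a : ℝ)) (he : (e : Set (Polynomial F)) ⊆ S) :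
    C a * q ^ 2 * ∏ g ∈ e, g ∈ genPreordering F S :=
  AddSubmonoid.subset_closure ⟨a, q, e, ha, he, rfl⟩

theorem C_mul_sq_mem_genPreordering {a : F} (q : Polynomial F) (ha : 0 ≤ (a : ℝ)) :
    C a * q ^ 2 ∈ genPreordering F S := by
  simpa using term_mem_genPreordering (S := S) q (e := ∅) ha (by simp)

theorem C_mem_genPreordering {a : F} (ha : 0 ≤ (a : ℝ)) : C a ∈ genPreordering F S := by
  simpa using C_mul_sq_mem_genPreordering (S := S) 1 ha

theorem sq_mem_genPreordering (q : Polynomial F) : q ^ 2 ∈ genPreordering F S := by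
  simpa using C_mul_sq_mem_genPreordering (S := S) (a := 1) q (by simp)

theorem subset_genPreordering : S ⊆ genPreordering F S := fun g hg => by
  simpa using term_mem_genPreordering (S := S) (a := 1) 1 (e := {g}) (by simp) (by simpa using hg)

/-- Generators in a term must be distinct, so when two terms are multiplied, the generators common
to both are absorbed into the square. -/
theorem mul_mem_genPreordering {p q : Polynomial F} (hp : p ∈ genPreordering F S)
    (hq : q ∈ genPreordering F S) : p * q ∈ genPreordering F S := by
  classical
  refine AddSubmonoid.closure_induction (motive := fun p _ => p * q ∈ genPreordering F S)
    ?_ ?_ ?_ hp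
  · rintro _ ⟨a, u, e, ha, he, rfl⟩
    refine AddSubmonoid.closure_induction
      (motive := fun q _ => C a * u ^ 2 * (∏ g ∈ e, g) * q ∈ genPreordering F S) ?_ ?_ ?_ hq
    · rintro _ ⟨b, v, d, hb, hd, rfl⟩
      have key : C a * u ^ 2 * (∏ g ∈ e, g) * (C b * v ^ 2 * ∏ g ∈ d, g) =
          C (a * b) * (u * v * ∏ g ∈ e ∩ d, g) ^ 2 * ∏ g ∈ symmDiff e d, g := by
        have h1 : (∏ g ∈ e, g) * ∏ g ∈ d, g = (∏ g ∈ e ∪ d, g) * ∏ g ∈ e ∩ d, g :=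
          (Finset.prod_union_inter).symm
        have h2 : ∏ g ∈ e ∪ d, g = (∏ g ∈ symmDiff e d, g) * ∏ g ∈ e ∩ d, g := by
          rw [← Finset.prod_union]
          · congr 1
            ext g
            simp only [Finset.mem_union, Finset.mem_symmDiff, Finset.mem_inter]
            tauto
          · rw [Finset.disjoint_left]
            intro g
            simp only [Finset.mem_symmDiff, Finset.mem_inter]
            tauto
        calc _ = C a * C b * (u * v) ^ 2 * ((∏ g ∈ e, g) * ∏ g ∈ d, g) := by ring
          _ = _ := by rw [h1, h2, C_mul]; ring
      rw [key]
      refine term_mem_genPreordering _ (by push_cast; positivity) ?_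
      intro g hg
      simp only [Finset.mem_coe, Finset.mem_symmDiff] at hg
      rcases hg with hg | hg
      · exact he hg.1
      · exact hd hg.1
    · simpa using zero_mem_genPreordering
    · intro x y _ _ hx hy
      rw [mul_add]
      exact add_mem_genPreordering hx hy
  · simpa using zero_mem_genPreordering
  · intro x y _ _ hx hy
    rw [add_mul]
    exact add_mem_genPreordering hx hy

theorem genPreordering_subset_posPoly {K : Set ℝ} (h : S ⊆ posPoly F K) :
    genPreordering F S ⊆ posPoly F K := by
  intro p hp x hx
  refine AddSubmonoid.closure_induction (motive := fun p _ => 0 ≤ aeval x p) ?_ ?_ ?_ hp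
  · rintro _ ⟨a, u, e, ha, he, rfl⟩
    rw [map_mul, map_mul, map_pow, aeval_C, map_prod]
    exact mul_nonneg (mul_nonneg ha (sq_nonneg _)) (Finset.prod_nonneg fun g hg => h (he hg) x hx)
  · simp
  · intro p q _ _ hp hq
    rw [map_add]
    exact add_nonneg hp hq

/-- A product of two linear factors whose roots lie in a common gap is a nonnegative combination of
the gap generator and squares. -/
theorem mul_mem_genPreordering_of_gap {a b c d : F} (hab : a < b) (hac : a ≤ c) (hcd : c ≤ d)
    (hdb : d ≤ b) (h : (X - C a) * (X - C b) ∈ genPreordering F S) :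
    (X - C c) * (X - C d) ∈ genPreordering F S := by
  have h1 : (X - C a) * (X - C d) ∈ genPreordering F S := by
    have hb : b - a ≠ 0 := (sub_pos.2 hab).ne'
    -- Since `d` lies between `a` and `b`, `X - d` is a convex combination of `X - a` and `X - b`;
    -- multiply by `X - a`. The second identity below moves `a` to `c` in the same way.
    have e : (X - C a) * (X - C d) = C ((d - a) / (b - a)) * ((X - C a) * (X - C b)) +
        C ((b - d) / (b - a)) * (X - C a) ^ 2 := by
      apply Polynomial.funext
      intro x
      simp only [eval_mul, eval_sub, eval_X, eval_C, eval_add, eval_pow]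
      field_simp
      ring
    rw [e]
    refine add_mem_genPreordering (mul_mem_genPreordering (C_mem_genPreordering ?_) h)
      (C_mul_sq_mem_genPreordering _ ?_)
    · exact_mod_cast div_nonneg (sub_nonneg.2 (hac.trans hcd)) (sub_pos.2 hab).le
    · exact_mod_cast div_nonneg (sub_nonneg.2 hdb) (sub_pos.2 hab).le
  rcases (hac.trans hcd).eq_or_lt with had | had
  · have : c = d := le_antisymm hcd (had ▸ hac)
    rw [this, ← sq]
    exact sq_mem_genPreordering _
  · have hd : d - a ≠ 0 := (sub_pos.2 had).ne'
    have e : (X - C c) * (X - C d) = C ((d - c) / (d - a)) * ((X - C a) * (X - C d)) +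
        C ((c - a) / (d - a)) * (X - C d) ^ 2 := by
      apply Polynomial.funext
      intro x
      simp only [eval_mul, eval_sub, eval_X, eval_C, eval_add, eval_pow]
      field_simp
      ring
    rw [e]
    refine add_mem_genPreordering (mul_mem_genPreordering (C_mem_genPreordering ?_) h1)
      (C_mul_sq_mem_genPreordering _ ?_)
    · exact_mod_cast div_nonneg (sub_nonneg.2 hcd) (sub_pos.2 had).le
    · exact_mod_cast div_nonneg (sub_nonneg.2 hac) (sub_pos.2 had).le

end Preordering

/-! ### Gaps of a closed subset of the line. -/

section Gaps

variable {M : Set ℝ}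

/-- Take for `a` the largest point of `M` below `y`. It is not interior, because `M` has no points
immediately to its right. -/
theorem IsClosed.exists_frontier_lt_of_notMem (hM : IsClosed M) {y : ℝ} (hy : y ∉ M)
    (h : (M ∩ Iio y).Nonempty) : ∃ a ∈ frontier M, a < y ∧ Ioc a y ∩ M = ∅ := by
  have hne : (M ∩ Iic y).Nonempty := h.mono fun x hx => ⟨hx.1, le_of_lt (mem_Iio.1 hx.2)⟩
  have hbd : BddAbove (M ∩ Iic y) := ⟨y, fun x hx => hx.2⟩
  have ha := (hM.inter isClosed_Iic).csSup_mem hne hbd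
  set a := sSup (M ∩ Iic y)
  have hay : a < y := lt_of_le_of_ne ha.2 fun e => hy (e ▸ ha.1)
  have hgap : Ioc a y ∩ M = ∅ := by
    ext x
    simp only [mem_inter_iff, mem_Ioc, mem_empty_iff_false, iff_false]
    rintro ⟨⟨h1, h2⟩, h3⟩
    exact absurd (le_csSup hbd ⟨h3, h2⟩) (not_le.2 h1)
  refine ⟨a, ⟨subset_closure ha.1, fun hi => ?_⟩, hay, hgap⟩
  obtain ⟨u, hu, hs⟩ := mem_nhdsGE_iff_exists_Ico_subset.1
    (mem_nhdsWithin_of_mem_nhds (mem_interior_iff_mem_nhds.1 hi) : M ∈ nhdsWithin a (Ici a))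
  have hu : a < u := hu
  obtain ⟨x, hx1, hx2⟩ := exists_between (lt_min hu hay)
  have : x ∈ Ioc a y ∩ M :=
    ⟨⟨hx1, (hx2.trans_le (min_le_right _ _)).le⟩, hs ⟨hx1.le, hx2.trans_le (min_le_left _ _)⟩⟩
  rw [hgap] at this
  exact this

theorem IsClosed.exists_frontier_gt_of_notMem (hM : IsClosed M) {y : ℝ} (hy : y ∉ M)
    (h : (M ∩ Ioi y).Nonempty) : ∃ b ∈ frontier M, y < b ∧ Ico y b ∩ M = ∅ := by
  have hN : IsClosed (-M) := hM.neg
  obtain ⟨a, ha, hay, hg⟩ := hN.exists_frontier_lt_of_notMem (y := -y) (by simpa using hy) (by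
    obtain ⟨x, hx, hxy⟩ := h
    exact ⟨-x, by simpa using hx, by simpa using hxy⟩)
  have hf : frontier (-M) = -frontier M := ((Homeomorph.neg ℝ).preimage_frontier M).symm
  refine ⟨-a, by rwa [hf] at ha, by linarith, ?_⟩
  ext x
  simp only [mem_inter_iff, mem_Ico, mem_empty_iff_false, iff_false]
  rintro ⟨⟨h1, h2⟩, h3⟩
  have : -x ∈ Ioc a (-y) ∩ -M := ⟨⟨by linarith, by linarith⟩, by simpa using h3⟩
  rw [hg] at this
  exact this

/-- A point outside a nonempty closed set lies in one of its three kinds of gaps. -/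
theorem IsClosed.gap_cases (hM : IsClosed M) (hne : M.Nonempty) {y : ℝ} (hy : y ∉ M) :
    (∃ a ∈ frontier M, y < a ∧ Iio a ∩ M = ∅) ∨ (∃ a ∈ frontier M, a < y ∧ Ioi a ∩ M = ∅) ∨
      ∃ a ∈ frontier M, ∃ b ∈ frontier M, a < y ∧ y < b ∧ Ioo a b ∩ M = ∅ := by
  have hsplit : ∀ x ∈ M, x < y ∨ y < x := fun x hx => lt_or_gt_of_ne fun e => hy (e ▸ hx)
  by_cases h1 : (M ∩ Iio y).Nonempty
  · obtain ⟨a, ha, hay, hga⟩ := hM.exists_frontier_lt_of_notMem hy h1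
    by_cases h2 : (M ∩ Ioi y).Nonempty
    · obtain ⟨b, hb, hby, hgb⟩ := hM.exists_frontier_gt_of_notMem hy h2
      refine Or.inr (Or.inr ⟨a, ha, b, hb, hay, hby, ?_⟩)
      rw [← Ioc_union_Ioo_eq_Ioo hay.le hby, union_inter_distrib_right, hga, empty_union]
      exact subset_eq_empty (inter_subset_inter_left _ Ioo_subset_Ico_self) hgb
    · refine Or.inr (Or.inl ⟨a, ha, hay, ?_⟩)
      ext x
      simp only [mem_inter_iff, mem_Ioi, mem_empty_iff_false, iff_false]
      rintro ⟨hx, hxM⟩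
      rcases hsplit x hxM with h | h
      · exact (hga ▸ (⟨⟨hx, h.le⟩, hxM⟩ : x ∈ Ioc a y ∩ M) : x ∈ (∅ : Set ℝ))
      · exact h2 ⟨x, hxM, h⟩
  · have h2 : (M ∩ Ioi y).Nonempty := by
      obtain ⟨x, hx⟩ := hne
      rcases hsplit x hx with h | h
      · exact absurd ⟨x, hx, h⟩ h1
      · exact ⟨x, hx, h⟩
    obtain ⟨b, hb, hby, hgb⟩ := hM.exists_frontier_gt_of_notMem hy h2
    refine Or.inl ⟨b, hb, hby, ?_⟩
    ext x
    simp only [mem_inter_iff, mem_Iio, mem_empty_iff_false, iff_false]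
    rintro ⟨hx, hxM⟩
    rcases hsplit x hxM with h | h
    · exact h1 ⟨x, hxM, h⟩
    · exact (hgb ▸ (⟨⟨h.le, hx⟩, hxM⟩ : x ∈ Ico y b ∩ M) : x ∈ (∅ : Set ℝ))

end Gaps

/-! ### Natural generators cut out the set. -/

section NaturalGenerators

variable {F : Subfield ℝ} {M : Set ℝ}

theorem naturalGenerators_subset_posPoly : naturalGenerators F M ⊆ posPoly F M := by
  rintro g (⟨-, rfl⟩ | ⟨a, -, h, rfl⟩ | ⟨a, -, h, rfl⟩ | ⟨a, b, -, -, hab, h, rfl⟩) x hx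
  · simp
  · have : ¬ x < a := fun hxa => (h ▸ (⟨hxa, hx⟩ : x ∈ Iio (a : ℝ) ∩ M) : x ∈ (∅ : Set ℝ))
    rw [map_sub, aeval_X, aeval_C]
    exact sub_nonneg.2 (not_lt.1 this)
  · have : ¬ (a : ℝ) < x := fun hxa => (h ▸ (⟨hxa, hx⟩ : x ∈ Ioi (a : ℝ) ∩ M) : x ∈ (∅ : Set ℝ))
    rw [map_sub, aeval_X, aeval_C]
    exact sub_nonneg.2 (not_lt.1 this)
  · have : ¬ ((a : ℝ) < x ∧ x < b) := fun hxa =>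
      (h ▸ (⟨hxa, hx⟩ : x ∈ Ioo (a : ℝ) b ∩ M) : x ∈ (∅ : Set ℝ))
    simp only [map_mul, map_sub, aeval_X, aeval_C]
    change 0 ≤ (x - (a : ℝ)) * (x - b)
    rcases le_or_gt x a with h1 | h1
    · exact mul_nonneg_of_nonpos_of_nonpos (by linarith) (by linarith)
    · have : (b : ℝ) ≤ x := not_lt.1 fun h2 => this ⟨h1, h2⟩
      exact mul_nonneg (by linarith) (by linarith)

theorem naturalGenerators_finite (hfin : (frontier M).Finite) :
    (naturalGenerators F M).Finite := by
  have hA : {a : F | (a : ℝ) ∈ frontier M}.Finite :=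
    hfin.preimage Subtype.val_injective.injOn
  refine ((((finite_singleton (1 : Polynomial F)).union (hA.image fun a => X - C a)).union
    (hA.image fun a => C a - X)).union
      ((hA.prod hA).image fun q => (X - C q.1) * (X - C q.2))).subset ?_
  rintro g (⟨-, rfl⟩ | ⟨a, ha, h, rfl⟩ | ⟨a, ha, h, rfl⟩ | ⟨a, b, ha, hb, hab, h, rfl⟩)
  · exact Or.inl (Or.inl (Or.inl rfl))
  · exact Or.inl (Or.inl (Or.inr ⟨a, ha, rfl⟩))
  · exact Or.inl (Or.inr ⟨a, ha, rfl⟩)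
  · exact Or.inr ⟨(a, b), ⟨ha, hb⟩, rfl⟩

/-- A point outside `M` lies in a gap, and the generator attached to that gap is negative there. -/
theorem basicClosedSet_naturalGenerators (hM : IsClosed M) (hne : M.Nonempty)
    (hF : frontier M ⊆ (F : Set ℝ)) : basicClosedSet F (naturalGenerators F M) = M := by
  refine Subset.antisymm (fun y hy => ?_) fun x hx g hg =>
    naturalGenerators_subset_posPoly hg x hx
  by_contra hyM
  rcases hM.gap_cases hne hyM with ⟨a, ha, hya, hg⟩ | ⟨a, ha, hya, hg⟩ |
    ⟨a, ha, b, hb, hay, hyb, hg⟩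
  · have := hy _ (Or.inr (Or.inl ⟨⟨a, hF ha⟩, ha, hg, rfl⟩))
    simp only [map_sub, aeval_X, aeval_C] at this
    change 0 ≤ y - a at this
    linarith
  · have := hy _ (Or.inr (Or.inr (Or.inl ⟨⟨a, hF ha⟩, ha, hg, rfl⟩)))
    simp only [map_sub, aeval_X, aeval_C] at this
    change 0 ≤ a - y at this
    linarith
  · have := hy _ (Or.inr (Or.inr (Or.inr ⟨⟨a, hF ha⟩, ⟨b, hF hb⟩, ha, hb, hay.trans hyb, hg, rfl⟩)))
    simp only [map_mul, map_sub, aeval_X, aeval_C] at this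
    change 0 ≤ (y - a) * (y - b) at this
    nlinarith [mul_pos (sub_pos.2 hay) (sub_pos.2 hyb)]

end NaturalGenerators

/-! ### Approximating real polynomials over `F` with roots in `F` kept. -/

section RootApproximation

/-- The polynomials `p n` over `F` converge coefficientwise to `g`, their degrees do not exceed that
of `g`, and they keep the roots that `g` has in `F`, with multiplicities. -/
structure RootApprox (F : Subfield ℝ) (p : ℕ → Polynomial F) (g : Polynomial ℝ) : Prop where
  natDegree_le : ∀ n, (p n).natDegree ≤ g.natDegree
  pow_dvd : ∀ n (a : F) m, (X - C (a : ℝ)) ^ m ∣ g → (X - C a) ^ m ∣ p n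
  tendsto : ∀ k, Tendsto (fun n => ((p n).coeff k : ℝ)) atTop (nhds (g.coeff k))

variable {F : Subfield ℝ}

theorem RootApprox.mul {p q : ℕ → Polynomial F} {g h : Polynomial ℝ} (hp : RootApprox F p g)
    (hq : RootApprox F q h) (hg : g ≠ 0) (hh : h ≠ 0) :
    RootApprox F (fun n => p n * q n) (g * h) where
  natDegree_le n := by
    rw [natDegree_mul hg hh]
    exact natDegree_mul_le.trans (add_le_add (hp.natDegree_le n) (hq.natDegree_le n))
  pow_dvd n a m hm := by
    rw [← le_rootMultiplicity_iff (mul_ne_zero hg hh), rootMultiplicity_mul (mul_ne_zero hg hh)]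
      at hm
    refine (pow_dvd_pow _ hm).trans ?_
    rw [pow_add]
    exact mul_dvd_mul (hp.pow_dvd n a _ (pow_rootMultiplicity_dvd _ _))
      (hq.pow_dvd n a _ (pow_rootMultiplicity_dvd _ _))
  tendsto k := by
    simp only [coeff_mul]
    push_cast
    exact tendsto_finsetSum _ fun i _ => (hp.tendsto i.1).mul (hq.tendsto i.2)

/-- Without real zeros there are no multiplicities to preserve. -/
theorem RootApprox.of_forall_eval_ne_zero {p : ℕ → Polynomial F} {g : Polynomial ℝ}
    (hdeg : ∀ n, (p n).natDegree ≤ g.natDegree) (hg : ∀ x, g.eval x ≠ 0)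
    (ht : ∀ k, Tendsto (fun n => ((p n).coeff k : ℝ)) atTop (nhds (g.coeff k))) :
    RootApprox F p g where
  natDegree_le := hdeg
  pow_dvd n a m hm := by
    rcases m with _ | m
    · simp
    · exact absurd (dvd_iff_isRoot.1 ((dvd_pow_self _ m.succ_ne_zero).trans hm)) (hg a)
  tendsto := ht

theorem RootApprox.C {u : ℕ → F} {c : ℝ} (hc : c ≠ 0)
    (hu : Tendsto (fun n => (u n : ℝ)) atTop (nhds c)) :
    RootApprox F (fun n => C (u n)) (C c) := by
  refine .of_forall_eval_ne_zero (by simp) (by simpa using hc) fun k => ?_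
  simp only [coeff_C]
  split_ifs
  · exact hu
  · simp

theorem RootApprox.X_sub_C {u : ℕ → F} {c : ℝ} (hu : Tendsto (fun n => (u n : ℝ)) atTop (nhds c))
    (hF : ∀ a : F, (a : ℝ) = c → ∀ n, u n = a) :
    RootApprox F (fun n => X - Polynomial.C (u n)) (X - Polynomial.C c) where
  natDegree_le n := by rw [natDegree_X_sub_C, natDegree_X_sub_C]
  pow_dvd n a m hm := by
    rcases m with _ | m
    · simp
    · have hroot := dvd_iff_isRoot.1 ((dvd_pow_self _ m.succ_ne_zero).trans hm)
      have hac : (a : ℝ) = c := sub_eq_zero.1 (by simpa using hroot)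
      have : m + 1 ≤ 1 := by
        have := natDegree_le_of_dvd hm (X_sub_C_ne_zero c)
        simpa using this
      obtain rfl : m = 0 := by omega
      simp [hF a hac n]
  tendsto k := by
    simp only [coeff_sub, coeff_X, coeff_C]
    split_ifs <;> push_cast <;> first | exact tendsto_const_nhds.sub hu | simp

theorem RootApprox.X_sub_C_sq_add {u w : ℕ → F} {c e : ℝ} (he : 0 < e)
    (hu : Tendsto (fun n => (u n : ℝ)) atTop (nhds c))
    (hw : Tendsto (fun n => (w n : ℝ)) atTop (nhds e)) :
    RootApprox F (fun n => (X - Polynomial.C (u n)) ^ 2 + Polynomial.C (w n))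
      ((X - Polynomial.C c) ^ 2 + Polynomial.C e) := by
  refine .of_forall_eval_ne_zero (fun n => ?_) (fun x => ?_) fun k => ?_
  · rw [natDegree_add_C, natDegree_add_C, natDegree_pow, natDegree_pow, natDegree_X_sub_C,
      natDegree_X_sub_C]
  · simp only [eval_add, eval_pow, eval_sub, eval_X, eval_C]
    positivity
  · have h1 : ∀ k, Tendsto (fun n => ((X - Polynomial.C (u n)).coeff k : ℝ)) atTop
        (nhds ((X - Polynomial.C c).coeff k)) := fun k => by
      simp only [coeff_sub, coeff_X, coeff_C]
      split_ifs <;> push_cast <;> first | exact tendsto_const_nhds.sub hu | simp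
    simp only [coeff_add, sq, coeff_mul, coeff_C]
    push_cast
    refine Tendsto.add (tendsto_finsetSum _ fun i _ => (h1 i.1).mul (h1 i.2)) ?_
    split_ifs
    · exact hw
    · simp

theorem Subfield.exists_mem_between (F : Subfield ℝ) {x y : ℝ} (h : x < y) :
    ∃ a : F, x < a ∧ (a : ℝ) < y := by
  obtain ⟨q, h1, h2⟩ := exists_rat_btwn h
  exact ⟨(q : F), by simpa using h1, by simpa using h2⟩

/-- A real number in an interval with endpoints in `F` is a limit of elements of `F` of this
interval; the sequence can be taken constant if the number is in `F`. -/
theorem Subfield.exists_tendsto_Icc (s t : F) {c : ℝ} (hsc : (s : ℝ) ≤ c) (hct : c ≤ t) :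
    ∃ u : ℕ → F, (∀ n, s ≤ u n) ∧ (∀ n, u n ≤ t) ∧
      Tendsto (fun n => (u n : ℝ)) atTop (nhds c) ∧ ∀ a : F, (a : ℝ) = c → ∀ n, u n = a := by
  by_cases hc : ∃ a : F, (a : ℝ) = c
  · obtain ⟨a, rfl⟩ := hc
    exact ⟨fun _ => a, fun _ => hsc, fun _ => hct, tendsto_const_nhds,
      fun b hb _ => (Subtype.ext hb).symm⟩
  · have hsc : (s : ℝ) < c := lt_of_le_of_ne hsc fun e => hc ⟨s, e⟩
    have hlt : ∀ n : ℕ, max (s : ℝ) (c - 1 / ((n : ℝ) + 1)) < c := fun n =>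
      max_lt hsc (sub_lt_self _ (by positivity))
    choose u hu1 hu2 using fun n => F.exists_mem_between (hlt n)
    refine ⟨u, fun n => ?_, fun n => ?_, ?_, fun a ha => absurd ⟨a, ha⟩ hc⟩
    · exact_mod_cast ((le_max_left _ _).trans (hu1 n).le)
    · exact_mod_cast ((hu2 n).le.trans hct)
    · refine tendsto_of_tendsto_of_tendsto_of_le_of_le (g := fun n : ℕ => c - 1 / ((n : ℝ) + 1))
        ?_ (tendsto_const_nhds (x := c)) (fun n => ((le_max_right _ _).trans (hu1 n).le))
        fun n => (hu2 n).le
      simpa using (tendsto_const_nhds (x := c)).sub tendsto_one_div_add_atTop_nhds_zero_nat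

theorem Subfield.exists_tendsto_Ici (s : F) {c : ℝ} (hsc : (s : ℝ) ≤ c) :
    ∃ u : ℕ → F, (∀ n, s ≤ u n) ∧
      Tendsto (fun n => (u n : ℝ)) atTop (nhds c) ∧ ∀ a : F, (a : ℝ) = c → ∀ n, u n = a := by
  obtain ⟨t, ht, -⟩ := F.exists_mem_between (lt_add_one c)
  obtain ⟨u, h1, -, h⟩ := Subfield.exists_tendsto_Icc s t hsc ht.le
  exact ⟨u, h1, h⟩

theorem Subfield.exists_tendsto_Iic (t : F) {c : ℝ} (hct : c ≤ (t : ℝ)) :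
    ∃ u : ℕ → F, (∀ n, u n ≤ t) ∧
      Tendsto (fun n => (u n : ℝ)) atTop (nhds c) ∧ ∀ a : F, (a : ℝ) = c → ∀ n, u n = a := by
  obtain ⟨s, -, hs⟩ := F.exists_mem_between (sub_one_lt c)
  obtain ⟨u, -, h1, h⟩ := Subfield.exists_tendsto_Icc s t hs.le hct
  exact ⟨u, h1, h⟩

theorem Subfield.exists_tendsto (F : Subfield ℝ) (c : ℝ) :
    ∃ u : ℕ → F, Tendsto (fun n => (u n : ℝ)) atTop (nhds c) ∧
      ∀ a : F, (a : ℝ) = c → ∀ n, u n = a := by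
  obtain ⟨s, -, hs⟩ := F.exists_mem_between (sub_one_lt c)
  obtain ⟨u, -, h⟩ := Subfield.exists_tendsto_Ici s hs.le
  exact ⟨u, h⟩

end RootApproximation

/-! ### Signs and roots of real polynomials. -/

section RealPolynomials

theorem Polynomial.eval_nonneg_of_forall_mem_Ioo {p : Polynomial ℝ} {a b : ℝ} (hab : a < b)
    (h : ∀ x ∈ Ioo a b, 0 ≤ p.eval x) : ∀ x ∈ Icc a b, 0 ≤ p.eval x := by
  intro x hx
  rw [← closure_Ioo hab.ne] at hx
  exact (isClosed_le continuous_const p.continuous).closure_subset_iff.2 h hx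

theorem Polynomial.eval_nonneg_of_frequently {p : Polynomial ℝ} {x : ℝ}
    (h : ∃ᶠ y in nhdsWithin x {x}ᶜ, 0 ≤ p.eval y) : 0 ≤ p.eval x :=
  (isClosed_Ici (a := (0 : ℝ))).mem_of_frequently_of_tendsto h
    (p.continuous.continuousAt.mono_left nhdsWithin_le_nhds)

/-- Take for `c` the largest point of `[a, y]` where `p` is nonnegative; negativity just to its
right forces `p` to vanish there. -/
theorem Polynomial.exists_last_root {p : Polynomial ℝ} {a y : ℝ} (hay : a < y)
    (ha : 0 ≤ p.eval a) (hy : p.eval y < 0) :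
    ∃ c, a ≤ c ∧ c < y ∧ p.eval c = 0 ∧ ∀ x ∈ Ioc c y, p.eval x < 0 := by
  have hcl : IsCompact (Icc a y ∩ {x | 0 ≤ p.eval x}) :=
    isCompact_Icc.inter_right (isClosed_le continuous_const p.continuous)
  obtain ⟨c, ⟨⟨hac, hcy⟩, hc0⟩, hmax⟩ := hcl.exists_isGreatest ⟨a, ⟨le_rfl, hay.le⟩, ha⟩
  have hcy : c < y := lt_of_le_of_ne hcy fun e => absurd hc0 (by simpa [e] using hy)
  have hneg : ∀ x ∈ Ioc c y, p.eval x < 0 := fun x hx => by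
    by_contra hx0
    exact absurd (hmax ⟨⟨hac.trans hx.1.le, hx.2⟩, not_lt.1 hx0⟩) (not_le.2 hx.1)
  refine ⟨c, hac, hcy, le_antisymm ?_ hc0, hneg⟩
  have := Polynomial.eval_nonneg_of_forall_mem_Ioo (p := -p) hcy
    (fun x hx => by simpa using (hneg x ⟨hx.1, hx.2.le⟩).le) c ⟨le_rfl, hcy.le⟩
  simpa using this

theorem Polynomial.exists_first_root {p : Polynomial ℝ} {b y : ℝ} (hyb : y < b)
    (hb : 0 ≤ p.eval b) (hy : p.eval y < 0) :
    ∃ d, d ≤ b ∧ y < d ∧ p.eval d = 0 ∧ ∀ x ∈ Ico y d, p.eval x < 0 := by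
  obtain ⟨c, h1, h2, h3, h4⟩ := Polynomial.exists_last_root (p := p.comp (-X)) (a := -b) (y := -y)
    (by linarith) (by simpa using hb) (by simpa using hy)
  refine ⟨-c, by linarith, by linarith, by simpa using h3, fun x hx => ?_⟩
  have := h4 (-x) ⟨by linarith [hx.2], by linarith [hx.1]⟩
  simpa using this

theorem Polynomial.X_sub_C_sq_dvd_of_isLocalMin {p : Polynomial ℝ} {c : ℝ} (hc : p.eval c = 0)
    (hmin : IsLocalMin (fun x => p.eval x) c) : ∃ q, p = (X - C c) ^ 2 * q := by
  obtain ⟨q, rfl⟩ := dvd_iff_isRoot.2 hc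
  have h1 := hmin.deriv_eq_zero
  rw [Polynomial.deriv] at h1
  have h2 : q.eval c = 0 := by simpa [derivative_mul] using h1
  obtain ⟨r, rfl⟩ := dvd_iff_isRoot.2 h2
  exact ⟨r, by ring⟩

end RealPolynomials

/-! ### Factoring over the reals and moving the factors into `F`. -/

section RealApproximation

/-- A nonconstant polynomial that is nonnegative on the line has a monic quadratic factor that is
nonnegative on the line. -/
theorem Polynomial.exists_quadratic_factor_of_nonneg {g : Polynomial ℝ} (hdeg : 0 < g.natDegree)
    (hg : ∀ x, 0 ≤ g.eval x) : ∃ c e q, 0 ≤ e ∧ g = ((X - C c) ^ 2 + C e) * q := by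
  obtain ⟨z, hz⟩ := IsAlgClosed.exists_aeval_eq_zero ℂ g (natDegree_pos_iff_degree_pos.1 hdeg).ne'
  by_cases him : z.im = 0
  · have hroot : g.eval z.re = 0 := by
      have hzr : z = algebraMap ℝ ℂ z.re := by
        apply Complex.ext <;> simp [him]
      rw [hzr, aeval_algebraMap_apply] at hz
      have : aeval z.re g = 0 := by simpa using hz
      simpa [coe_aeval_eq_eval] using this
    obtain ⟨q, hq⟩ := Polynomial.X_sub_C_sq_dvd_of_isLocalMin hroot
      (Eventually.of_forall fun x => by simpa [hroot] using hg x)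
    exact ⟨z.re, 0, q, le_rfl, by simpa using hq⟩
  · obtain ⟨q, hq⟩ := g.quadratic_dvd_of_aeval_eq_zero_im_ne_zero hz him
    refine ⟨z.re, z.im ^ 2, q, sq_nonneg _, ?_⟩
    rw [hq, Complex.sq_norm, Complex.normSq_apply]
    congr 1
    apply Polynomial.funext
    intro x
    simp only [eval_add, eval_sub, eval_mul, eval_pow, eval_X, eval_C]
    ring

variable {F : Subfield ℝ} {M : Set ℝ}

/-- A real polynomial that is nonnegative on `M` is approximated, with its roots in `F` kept, by
members of the preordering over `F` that the natural generators of `M` generate. -/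
theorem exists_rootApprox_mem_genPreordering (hM : IsClosed M) (hne : M.Nonempty)
    (hF : frontier M ⊆ (F : Set ℝ)) (N : ℕ) : ∀ g : Polynomial ℝ, g.natDegree ≤ N → g ≠ 0 →
      (∀ x ∈ M, 0 ≤ g.eval x) → ∃ p : ℕ → Polynomial F, RootApprox F p g ∧
        ∀ n, p n ∈ genPreordering F (naturalGenerators F M) := by
  induction N with
  | zero =>
    intro g hdeg hg0 hg
    obtain ⟨c, rfl⟩ : ∃ c, g = C c := ⟨_, eq_C_of_natDegree_le_zero hdeg⟩
    obtain ⟨x, hx⟩ := hne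
    have hc : c ≠ 0 := fun h => hg0 (by simp [h])
    obtain ⟨u, hu0, hu, -⟩ := Subfield.exists_tendsto_Ici (F := F) 0 (c := c)
      (by simpa using hg x hx)
    exact ⟨_, RootApprox.C hc hu, fun n => C_mem_genPreordering (hu0 n)⟩
  | succ N ih =>
    intro g hdeg hg0 hg
    -- The induction step common to all cases: a factor `q` already approximated inside the
    -- preordering may be removed if the cofactor stays nonnegative on `M`.
    have split : ∀ (q h : Polynomial ℝ) (r : ℕ → Polynomial F), g = q * h → 0 < q.natDegree →
        RootApprox F r q → (∀ n, r n ∈ genPreordering F (naturalGenerators F M)) →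
        (∀ x ∈ M, 0 ≤ h.eval x) → ∃ p : ℕ → Polynomial F, RootApprox F p g ∧
          ∀ n, p n ∈ genPreordering F (naturalGenerators F M) := by
      rintro q h r rfl hq hr hrT hh
      have hq0 : q ≠ 0 := left_ne_zero_of_mul hg0
      have hh0 : h ≠ 0 := right_ne_zero_of_mul hg0
      rw [natDegree_mul hq0 hh0] at hdeg
      obtain ⟨p, hp, hpT⟩ := ih h (by omega) hh0 hh
      exact ⟨_, hr.mul hp hq0 hh0, fun n => mul_mem_genPreordering (hrT n) (hpT n)⟩
    by_cases hpos : ∀ x, 0 ≤ g.eval x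
    · rcases Nat.eq_zero_or_pos g.natDegree with hd | hd
      · exact ih g (by omega) hg0 hg
      obtain ⟨c, e, q, he, hgq⟩ := Polynomial.exists_quadratic_factor_of_nonneg hd hpos
      have hq : ∀ x, 0 ≤ q.eval x := by
        intro x
        refine Polynomial.eval_nonneg_of_frequently (Eventually.frequently ?_)
        have : ∀ᶠ y in nhdsWithin x {x}ᶜ, y ≠ c :=
          nhdsNE_le_cofinite x (finite_singleton c).compl_mem_cofinite
        filter_upwards [this] with y hy
        have h1 := hpos y
        rw [hgq, eval_mul] at h1
        refine nonneg_of_mul_nonneg_right h1 ?_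
        simp only [eval_add, eval_pow, eval_sub, eval_X, eval_C]
        have := sub_ne_zero.2 hy
        positivity
      have hdq : 0 < ((X - C c) ^ 2 + C e).natDegree := by
        rw [natDegree_add_C, natDegree_pow, natDegree_X_sub_C]
        norm_num
      obtain ⟨u, hu, huF⟩ := F.exists_tendsto c
      obtain ⟨w, hw0, hw, -⟩ := Subfield.exists_tendsto_Ici (F := F) 0 (c := e) (by simpa using he)
      -- For `e = 0` the factor has the double root `c`, which must survive if it lies in `F`, so
      -- the approximants are exact squares; for `e > 0` there is no real root to keep.
      rcases he.eq_or_lt with rfl | he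
      · refine split _ q (fun n => (X - C (u n)) * (X - C (u n))) hgq hdq ?_ (fun n => ?_)
          fun x _ => hq x
        · have := RootApprox.X_sub_C hu huF
          simpa [sq] using this.mul this (X_sub_C_ne_zero c) (X_sub_C_ne_zero c)
        · rw [← sq]
          exact sq_mem_genPreordering _
      · exact split _ q _ hgq hdq (RootApprox.X_sub_C_sq_add he hu hw)
          (fun n => add_mem_genPreordering (sq_mem_genPreordering _) (C_mem_genPreordering (hw0 n)))
          fun x _ => hq x
    · obtain ⟨y, hy⟩ := not_forall.1 hpos
      have hy : g.eval y < 0 := not_le.1 hy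
      have hyM : y ∉ M := fun h => absurd (hg y h) (not_le.2 hy)
      have hmemM : ∀ a ∈ frontier M, 0 ≤ g.eval a := fun a ha => hg a (hM.frontier_subset ha)
      rcases hM.gap_cases hne hyM with ⟨a, ha, hya, hgap⟩ | ⟨a, ha, hay, hgap⟩ |
        ⟨a, ha, b, hb, hay, hyb, hgap⟩
      · obtain ⟨d, hda, hyd, hd0, hneg⟩ := Polynomial.exists_first_root hya (hmemM a ha) hy
        obtain ⟨h, hh⟩ := dvd_iff_isRoot.2 hd0
        obtain ⟨u, hu1, hu, huF⟩ := Subfield.exists_tendsto_Iic (⟨a, hF ha⟩ : F) hda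
        refine split _ h _ hh (by simp) (RootApprox.X_sub_C hu huF) (fun n => ?_) fun x hx => ?_
        · have e : X - C (u n) = (X - C (⟨a, hF ha⟩ : F)) + C (⟨a, hF ha⟩ - u n) := by
            rw [C_sub]; ring
          rw [e]
          exact add_mem_genPreordering (subset_genPreordering (Or.inr (Or.inl ⟨_, ha, hgap, rfl⟩)))
            (C_mem_genPreordering (by exact_mod_cast sub_nonneg.2 (hu1 n)))
        · have hax : a ≤ x := not_lt.1 fun hxa =>
            (hgap ▸ (⟨hxa, hx⟩ : x ∈ Iio a ∩ M) : x ∈ (∅ : Set ℝ))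
          -- At `x = d` division by `x - d` says nothing; the sign of `h` comes from the left, where
          -- both `g` and `X - d` are negative.
          rcases (hda.trans hax).eq_or_lt with rfl | hdx
          · refine Polynomial.eval_nonneg_of_forall_mem_Ioo hyd (fun z hz => ?_) d ⟨hyd.le, le_rfl⟩
            have h1 := hneg z ⟨hz.1.le, hz.2⟩
            rw [hh, eval_mul, eval_sub, eval_X, eval_C] at h1
            exact (pos_of_mul_neg_right h1 (sub_neg.2 hz.2).le).le
          · have h1 := hg x hx
            rw [hh, eval_mul, eval_sub, eval_X, eval_C] at h1
            exact nonneg_of_mul_nonneg_right h1 (sub_pos.2 hdx)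
      · obtain ⟨c, hac, hcy, hc0, hneg⟩ := Polynomial.exists_last_root hay (hmemM a ha) hy
        obtain ⟨h, hh⟩ := dvd_iff_isRoot.2 hc0
        obtain ⟨u, hu1, hu, huF⟩ := Subfield.exists_tendsto_Ici (⟨a, hF ha⟩ : F) hac
        -- The factor split off is `c - X`, written so that the product rule for `RootApprox`
        -- applies.
        refine split (C (-1) * (X - C c)) (-h) (fun n => C (-1) * (X - C (u n)))
          (by rw [hh, C_neg, C_1]; ring) (by rw [natDegree_C_mul (by norm_num)]; simp)
          ((RootApprox.C (u := fun _ => -1) (by norm_num) (by simp)).mul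
            (RootApprox.X_sub_C hu huF) (by simp) (X_sub_C_ne_zero c))
          (fun n => ?_) fun x hx => ?_
        · have e : C (-1) * (X - C (u n)) = (C (⟨a, hF ha⟩ : F) - X) + C (u n - ⟨a, hF ha⟩) := by
            rw [C_sub, C_neg, C_1]; ring
          rw [e]
          exact add_mem_genPreordering
            (subset_genPreordering (Or.inr (Or.inr (Or.inl ⟨_, ha, hgap, rfl⟩))))
            (C_mem_genPreordering (by exact_mod_cast sub_nonneg.2 (hu1 n)))
        · have hxa : x ≤ a := not_lt.1 fun hxa =>
            (hgap ▸ (⟨hxa, hx⟩ : x ∈ Ioi a ∩ M) : x ∈ (∅ : Set ℝ))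
          rcases (hxa.trans hac).eq_or_lt with rfl | hxc
          · refine Polynomial.eval_nonneg_of_forall_mem_Ioo hcy (fun z hz => ?_) x ⟨le_rfl, hcy.le⟩
            have h1 := hneg z ⟨hz.1, hz.2.le⟩
            rw [hh, eval_mul, eval_sub, eval_X, eval_C] at h1
            rw [eval_neg]
            exact (neg_pos.2 (neg_of_mul_neg_right h1 (sub_pos.2 hz.1).le)).le
          · have h1 := hg x hx
            rw [hh, eval_mul, eval_sub, eval_X, eval_C] at h1
            rw [eval_neg]
            nlinarith
      · obtain ⟨c, hac, hcy, hc0, hnegc⟩ := Polynomial.exists_last_root hay (hmemM a ha) hy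
        obtain ⟨d, hdb, hyd, hd0, hnegd⟩ := Polynomial.exists_first_root hyb (hmemM b hb) hy
        obtain ⟨h, hh⟩ : ∃ h, g = (X - C c) * (X - C d) * h := by
          obtain ⟨k, rfl⟩ := dvd_iff_isRoot.2 hc0
          have : k.eval d = 0 := by
            have h1 : (d - c) * k.eval d = 0 := by simpa using hd0
            exact (mul_eq_zero.1 h1).resolve_left (by linarith)
          obtain ⟨h, rfl⟩ := dvd_iff_isRoot.2 this
          exact ⟨h, by ring⟩
        -- The separator `t` in `F` keeps the approximants of `c` below those of `d`, so that both
        -- stay in the gap in the right order.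
        obtain ⟨t, ht1, ht2⟩ := F.exists_mem_between (hcy.trans hyd)
        obtain ⟨u, hu1, hu2, hu, huF⟩ := Subfield.exists_tendsto_Icc (⟨a, hF ha⟩ : F) t hac ht1.le
        obtain ⟨v, hv1, hv2, hv, hvF⟩ := Subfield.exists_tendsto_Icc t (⟨b, hF hb⟩ : F) ht2.le hdb
        have hneg : ∀ z ∈ Ioo c d, g.eval z < 0 := fun z hz => by
          rcases le_total z y with h1 | h1
          · exact hnegc z ⟨hz.1, h1⟩
          · exact hnegd z ⟨h1, hz.2⟩
        have hcd : c < d := hcy.trans hyd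
        have hIcc : ∀ z ∈ Icc c d, 0 ≤ h.eval z := by
          refine Polynomial.eval_nonneg_of_forall_mem_Ioo hcd fun z hz => ?_
          have h1 := hneg z hz
          rw [hh, eval_mul, eval_mul, eval_sub, eval_sub, eval_X, eval_C, eval_C] at h1
          exact (pos_of_mul_neg_right h1 (mul_neg_of_pos_of_neg (sub_pos.2 hz.1)
            (sub_neg.2 hz.2)).le).le
        refine split _ h _ hh
          (by rw [natDegree_mul (X_sub_C_ne_zero c) (X_sub_C_ne_zero d)]; simp)
          ((RootApprox.X_sub_C hu huF).mul (RootApprox.X_sub_C hv hvF) (X_sub_C_ne_zero c)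
            (X_sub_C_ne_zero d)) (fun n => ?_) fun x hx => ?_
        · have hab : a < b := hay.trans hyb
          exact mul_mem_genPreordering_of_gap (a := ⟨a, hF ha⟩) (b := ⟨b, hF hb⟩) hab (hu1 n)
            ((hu2 n).trans (hv1 n)) (hv2 n)
            (subset_genPreordering (Or.inr (Or.inr (Or.inr ⟨_, _, ha, hb, hab, hgap, rfl⟩))))
        · by_cases hxI : x ∈ Icc c d
          · exact hIcc x hxI
          · have h1 := hg x hx
            rw [hh, eval_mul, eval_mul, eval_sub, eval_sub, eval_X, eval_C, eval_C] at h1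
            refine nonneg_of_mul_nonneg_right h1 ?_
            rcases lt_or_ge x c with h2 | h2
            · exact mul_pos_of_neg_of_neg (by linarith) (by linarith)
            · have : d < x := not_le.1 fun h3 => hxI ⟨h2, h3⟩
              exact mul_pos (by linarith) (by linarith)

end RealApproximation

/-! ### Convex hulls: from approximation to membership, and from the reals to `F`. -/

section Descent

/-- A vector over `F` in the real convex hull of vectors over `F` is one of their convex
combinations over `F`. -/
theorem exists_convex_combination_over_subfield (F : Subfield ℝ) {ι : Type} [Finite ι]
    {A : Set (ι → F)} {h : ι → F}
    (hh : (fun i => (h i : ℝ)) ∈ convexHull ℝ ((fun (v : ι → F) i => (v i : ℝ)) '' A)) :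
    ∃ (κ : Type) (_ : Fintype κ) (z : κ → ι → F) (w : κ → F), (∀ k, z k ∈ A) ∧
      (∀ k, 0 ≤ (w k : ℝ)) ∧ ∑ k, w k • z k = h := by
  obtain ⟨κ, _, z, w, hz, hind, hw, hw1, hwz⟩ := eq_pos_convex_span_of_mem_convexHull hh
  choose y hyA hyz using fun k => hz ⟨k, rfl⟩
  -- An `F`-linear retraction of the reals onto `F`, applied to the weights, gives weights in `F`
  -- with the same sum and the same combination. By affine independence they are the original
  -- weights, hence positive.
  obtain ⟨φ, hφ⟩ := (Algebra.linearMap F ℝ).exists_leftInverse_of_injective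
    (LinearMap.ker_eq_bot.2 (algebraMap F ℝ).injective)
  have hφ1 : ∀ a : F, φ (a : ℝ) = a := fun a => LinearMap.congr_fun hφ a
  have hφm : ∀ (r : ℝ) (a : F), φ (r * a) = φ r * a := fun r a => by
    have : r * (a : ℝ) = a • r := by rw [mul_comm]; rfl
    rw [this, map_smul, smul_eq_mul, mul_comm]
  have hsum : ∑ k, φ (w k) • y k = h := by
    funext i
    have h1 := congrFun hwz i
    simp only [Finset.sum_apply, Pi.smul_apply, smul_eq_mul, ← hyz] at h1 ⊢
    have h2 := congrArg φ h1
    rw [map_sum, hφ1] at h2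
    simpa only [hφm] using h2
  have hsum1 : ∑ k, φ (w k) = 1 := by
    have := congrArg φ hw1
    rw [map_sum] at this
    simpa using this.trans (hφ1 1)
  have heq : ∀ k, ((φ (w k) : F) : ℝ) = w k := by
    have hsub := affineIndependent_iff.1 hind Finset.univ (fun k => (φ (w k) : ℝ) - w k) (by
      rw [Finset.sum_sub_distrib, hw1, ← AddSubmonoidClass.coe_finsetSum, hsum1]
      simp) (by
      simp only [sub_smul]
      rw [Finset.sum_sub_distrib, hwz, sub_eq_zero]
      funext i
      rw [← hsum]
      simp [← hyz])
    exact fun k => sub_eq_zero.1 (hsub k (Finset.mem_univ k))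
  exact ⟨κ, inferInstance, y, fun k => φ (w k), hyA, fun k => by rw [heq]; exact (hw k).le, hsum⟩

/-- In finite dimension `s` and its closure have the same affine span, so `s` has interior points,
and then both have the same interior. -/
theorem Convex.mem_of_closure_mem_nhds {V : Type*} [NormedAddCommGroup V] [NormedSpace ℝ V]
    [FiniteDimensional ℝ V] {s : Set V} (hs : Convex ℝ s) {x : V} (h : closure s ∈ nhds x) :
    x ∈ s := by
  have hx : x ∈ interior (closure s) := mem_interior_iff_mem_nhds.2 h
  have hne : (interior s).Nonempty := by
    rw [hs.interior_nonempty_iff_affineSpan_eq_top]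
    have h1 : affineSpan ℝ (closure s) = ⊤ :=
      (hs.closure.interior_nonempty_iff_affineSpan_eq_top).1 ⟨x, hx⟩
    have h2 : closure s ⊆ affineSpan ℝ s :=
      closure_minimal (subset_affineSpan ℝ s) (AffineSubspace.closed_of_finiteDimensional _)
    rw [eq_top_iff, ← h1]
    exact affineSpan_le.2 h2
  rw [hs.interior_closure_eq_interior_of_nonempty_interior hne] at hx
  exact interior_subset hx

end Descent

/-! ### Stability of signs under perturbation of coefficients. -/

section Stability

theorem Polynomial.exists_geom_sum_le_mul_abs_eval {h : Polynomial ℝ} (h0 : h ≠ 0) :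
    ∃ c > 0, ∀ᶠ x in atTop, c * ∑ k ∈ Finset.range (h.natDegree + 1), |x| ^ k ≤ |h.eval x| := by
  set B : Polynomial ℝ := ∑ k ∈ Finset.range (h.natDegree + 1), X ^ k
  have hB : B.degree ≤ h.degree := by
    rw [degree_eq_natDegree h0]
    refine (degree_sum_le _ _).trans (Finset.sup_le fun k hk => ?_)
    rw [degree_X_pow]
    exact_mod_cast Nat.lt_succ_iff.1 (Finset.mem_range.1 hk)
  obtain ⟨C, hC, hb⟩ := (Polynomial.isBigO_atTop_of_degree_le B h hB).exists_pos
  refine ⟨C⁻¹, inv_pos.2 hC, ?_⟩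
  filter_upwards [hb.bound, eventually_ge_atTop 0] with x hx hx0
  rw [Real.norm_eq_abs, Real.norm_eq_abs] at hx
  have e : B.eval x = ∑ k ∈ Finset.range (h.natDegree + 1), |x| ^ k := by
    simp [B, eval_finsetSum, abs_of_nonneg hx0]
  rw [← e, inv_mul_le_iff₀ hC]
  exact (le_abs_self _).trans hx

/-- A polynomial without zeros on a closed set keeps its sign there under small changes of its
coefficients that do not increase the degree. -/
theorem Polynomial.exists_coeff_perturbation {M : Set ℝ} (hM : IsClosed M) {h : Polynomial ℝ}
    (h0 : h ≠ 0) (hz : ∀ x ∈ M, h.eval x ≠ 0) :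
    ∃ δ > 0, ∀ q : Polynomial ℝ, q.natDegree ≤ h.natDegree →
      (∀ k ≤ h.natDegree, |q.coeff k - h.coeff k| < δ) → ∀ x ∈ M, 0 < q.eval x * h.eval x := by
  -- The value at `x` changes by at most `B x` times the largest coefficient change. So `δ` is a
  -- lower bound for `|h| / B` on `M`, found near both infinities by comparing degrees and on a
  -- compact part by continuity.
  set B : ℝ → ℝ := fun x => ∑ k ∈ Finset.range (h.natDegree + 1), |x| ^ k with hBdef
  have hBcont : Continuous B := by fun_prop
  have hBpos : ∀ x, 0 < B x := fun x => by
    rw [hBdef]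
    simp only [Finset.sum_range_succ', pow_zero]
    positivity
  obtain ⟨c₁, hc₁, htop⟩ := Polynomial.exists_geom_sum_le_mul_abs_eval h0
  have hn0 : h.comp (-X) ≠ 0 := by rwa [Ne, comp_neg_X_eq_zero_iff]
  obtain ⟨c₂, hc₂, hbot⟩ := Polynomial.exists_geom_sum_le_mul_abs_eval hn0
  have hbot : ∀ᶠ x in atBot, c₂ * B x ≤ |h.eval x| := by
    have := tendsto_neg_atBot_atTop.eventually hbot
    filter_upwards [this] with x hx
    simpa [natDegree_comp, hBdef] using hx
  have hcoc : ∀ᶠ x in cocompact ℝ, min c₁ c₂ * B x ≤ |h.eval x| := by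
    rw [cocompact_eq_atBot_atTop]
    refine eventually_sup.2 ⟨?_, ?_⟩
    · filter_upwards [hbot] with x hx
      exact (mul_le_mul_of_nonneg_right (min_le_right _ _) (hBpos x).le).trans hx
    · filter_upwards [htop] with x hx
      exact (mul_le_mul_of_nonneg_right (min_le_left _ _) (hBpos x).le).trans hx
  obtain ⟨Q, hQ, hQc⟩ := mem_cocompact.1 hcoc
  obtain ⟨c₃, hc₃, hcomp⟩ := (hQ.inter_right hM).exists_forall_le'
    (f := fun x => |h.eval x| / B x) (by
      exact ((h.continuous.abs).div hBcont fun x => (hBpos x).ne').continuousOn) (a := 0)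
    fun x hx => div_pos (abs_pos.2 (hz x hx.2)) (hBpos x)
  refine ⟨min (min c₁ c₂) c₃, lt_min (lt_min hc₁ hc₂) hc₃, fun q hq hqh x hx => ?_⟩
  have hlow : min (min c₁ c₂) c₃ * B x ≤ |h.eval x| := by
    by_cases hxQ : x ∈ Q
    · refine (mul_le_mul_of_nonneg_right (min_le_right _ _) (hBpos x).le).trans ?_
      exact (le_div_iff₀ (hBpos x)).1 (hcomp x ⟨hxQ, hx⟩)
    · exact (mul_le_mul_of_nonneg_right (min_le_left _ _) (hBpos x).le).trans (hQc hxQ)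
  have hdiff : |q.eval x - h.eval x| < min (min c₁ c₂) c₃ * B x := by
    rw [eval_eq_sum_range' (Nat.lt_succ_of_le hq), eval_eq_sum_range, ← Finset.sum_sub_distrib,
      hBdef, Finset.mul_sum]
    -- Strictness comes from the constant term, the only one whose weight `|x| ^ k` is positive at
    -- every `x`.
    refine (Finset.abs_sum_le_sum_abs _ _).trans_lt (Finset.sum_lt_sum (fun k hk => ?_)
      ⟨0, by simp, by simpa using hqh 0 (Nat.zero_le _)⟩)
    rw [← sub_mul, abs_mul, abs_pow]
    exact mul_le_mul_of_nonneg_right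
      (hqh k (Nat.lt_succ_iff.1 (Finset.mem_range.1 hk))).le (by positivity)
  have hlt := hdiff.trans_le hlow
  rcases lt_or_gt_of_ne (hz x hx) with hneg | hpos
  · rw [abs_of_neg hneg] at hlt
    exact mul_pos_of_neg_of_neg (by linarith [(abs_lt.1 hlt).2]) hneg
  · rw [abs_of_pos hpos] at hlt
    exact mul_pos (by linarith [(abs_lt.1 hlt).1]) hpos

end Stability

/-! ### Dividing approximations by linear factors. -/

section Division

/-- Dividing by `X - a` recovers each coefficient from the next higher one; descend from above the
common degree bound `N`. -/
theorem Polynomial.tendsto_coeff_of_X_sub_C_mul {p : ℕ → Polynomial ℝ} {q : Polynomial ℝ} {a : ℝ}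
    {N : ℕ} (hp : ∀ n, (p n).natDegree ≤ N) (hq : q.natDegree ≤ N)
    (h : ∀ k, Tendsto (fun n => ((X - C a) * p n).coeff k) atTop
      (nhds (((X - C a) * q).coeff k))) (k : ℕ) :
    Tendsto (fun n => (p n).coeff k) atTop (nhds (q.coeff k)) := by
  have big : ∀ k, N < k → Tendsto (fun n => (p n).coeff k) atTop (nhds (q.coeff k)) := by
    intro k hk
    rw [coeff_eq_zero_of_natDegree_lt (hq.trans_lt hk)]
    simp [coeff_eq_zero_of_natDegree_lt ((hp _).trans_lt hk)]
  have hrec : ∀ (r : Polynomial ℝ) k, r.coeff k = ((X - C a) * r).coeff (k + 1) + a * r.coeff (k + 1) :=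
    fun r k => by rw [sub_mul, coeff_sub, coeff_X_mul, coeff_C_mul]; ring
  have down : ∀ j k, N + 1 ≤ k + j →
      Tendsto (fun n => (p n).coeff k) atTop (nhds (q.coeff k)) := by
    intro j
    induction j with
    | zero => exact fun k hk => big k (by omega)
    | succ j ih =>
      intro k hk
      rw [hrec q k]
      simp only [hrec (p _) k]
      exact (h (k + 1)).add ((ih (k + 1) (by omega)).const_mul a)
  exact down (N + 1) k (by omega)

theorem Polynomial.tendsto_coeff_of_prod_X_sub_C_mul (s : Multiset ℝ) {p : ℕ → Polynomial ℝ}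
    {q : Polynomial ℝ} {N : ℕ} (hp : ∀ n, (p n).natDegree ≤ N) (hq : q.natDegree ≤ N)
    (h : ∀ k, Tendsto (fun n => ((s.map fun a => X - C a).prod * p n).coeff k) atTop
      (nhds (((s.map fun a => X - C a).prod * q).coeff k))) (k : ℕ) :
    Tendsto (fun n => (p n).coeff k) atTop (nhds (q.coeff k)) := by
  induction s using Multiset.induction_on with
  | empty => simpa using h k
  | cons a s ih =>
    refine ih fun k => ?_
    simp only [Multiset.map_cons, Multiset.prod_cons, mul_assoc] at h
    have hdeg : ∀ r : Polynomial ℝ, r.natDegree ≤ N →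
        ((s.map fun a => X - C a).prod * r).natDegree ≤ s.card + N := fun r hr =>
      natDegree_mul_le.trans (by rw [natDegree_multiset_prod_X_sub_C_eq_card]; omega)
    exact Polynomial.tendsto_coeff_of_X_sub_C_mul (fun n => hdeg _ (hp n)) (hdeg _ hq) h k

theorem RootApprox.prod_X_sub_C_dvd {F : Subfield ℝ} {p : ℕ → Polynomial F} {s : Multiset F}
    {q : Polynomial ℝ} (hp : RootApprox F p ((s.map fun a : F => X - Polynomial.C (a : ℝ)).prod * q))
    (n : ℕ) : (s.map fun a => X - Polynomial.C a).prod ∣ p n := by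
  classical
  by_cases h0 : p n = 0
  · simp [h0]
  rw [Multiset.prod_X_sub_C_dvd_iff_le_roots h0, Multiset.le_iff_count]
  intro a
  rw [count_roots, le_rootMultiplicity_iff h0]
  refine hp.pow_dvd n a _ (Dvd.dvd.mul_right ?_ q)
  have := Multiset.prod_dvd_prod_of_le (Multiset.map_le_map
    (f := fun a : F => X - Polynomial.C (a : ℝ)) (Multiset.le_count_iff_replicate_le.1 le_rfl :
      Multiset.replicate (s.count a) a ≤ s))
  simpa using this

end Division

/-! ### Saturation of the preordering of natural generators. -/

section Saturation

variable {F : Subfield ℝ} {M : Set ℝ}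

/-- A zero on `M` outside `F` is a multiple zero, so that the square of its minimal polynomial
can be split off. -/
theorem exists_sq_factor_of_root_notMem (hF : frontier M ⊆ (F : Set ℝ)) {f : Polynomial F}
    (hf0 : f ≠ 0) (hf : f ∈ posPoly F M) {x : ℝ} (hx : x ∈ M) (hxF : x ∉ F)
    (hroot : aeval x f = 0) :
    ∃ p h : Polynomial F, f = p ^ 2 * h ∧ h.natDegree < f.natDegree ∧ h ∈ posPoly F M := by
  -- Boundary points lie in `F`, so a zero outside `F` is a local minimum of `f`, and `f'` vanishes
  -- there as well. Separability of `p` turns this into divisibility by `p ^ 2`.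
  have hint : ∀ y ∈ M, y ∉ F → M ∈ nhds y := fun y hy hyF => by
    by_contra hn
    exact hyF (hF ⟨subset_closure hy, fun hi => hn (mem_interior_iff_mem_nhds.1 hi)⟩)
  have halg : IsIntegral F x := isAlgebraic_iff_isIntegral.1 ⟨f, hf0, hroot⟩
  have hirr := minpoly.irreducible halg
  set p := minpoly F x with hp
  obtain ⟨k, hk⟩ := minpoly.dvd F x hroot
  rw [← hp] at hk
  have hder : aeval x (derivative f) = 0 := by
    have hmin : IsLocalMin (fun y => (f.map (algebraMap F ℝ)).eval y) x := by
      filter_upwards [hint x hx hxF] with y hy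
      rw [eval_map_algebraMap, eval_map_algebraMap, hroot]
      exact hf y hy
    have := hmin.deriv_eq_zero
    rwa [Polynomial.deriv, derivative_map, eval_map_algebraMap] at this
  have hkx : aeval x k = 0 := by
    have hsep : aeval x (derivative p) ≠ 0 := hirr.separable.aeval_derivative_ne_zero (minpoly.aeval F x)
    rw [hk, derivative_mul, map_add, map_mul, map_mul, minpoly.aeval, zero_mul, add_zero] at hder
    exact (mul_eq_zero.1 hder).resolve_left hsep
  obtain ⟨h, rfl⟩ := minpoly.dvd F x hkx
  rw [← hp, ← mul_assoc, ← sq] at hk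
  have hp0 : p ≠ 0 := hirr.ne_zero
  have hh0 : h ≠ 0 := by
    rintro rfl
    exact hf0 (by simpa using hk)
  refine ⟨p, h, hk, ?_, fun y hy => ?_⟩
  · rw [hk, natDegree_mul (pow_ne_zero 2 hp0) hh0, natDegree_pow]
    have := hirr.natDegree_pos
    omega
  have hquot : ∀ z ∈ M, aeval z p ≠ 0 → 0 ≤ aeval z h := fun z hz hpz => by
    have := hf z hz
    rw [hk, map_mul, map_pow] at this
    exact nonneg_of_mul_nonneg_right this (by positivity)
  by_cases hpy : aeval y p = 0
  · have hyF : y ∉ F := by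
      intro hyF
      have hr : p.IsRoot ⟨y, hyF⟩ := by
        have : aeval (algebraMap F ℝ ⟨y, hyF⟩) p = 0 := hpy
        rw [aeval_algebraMap_apply] at this
        exact (algebraMap F ℝ).injective (by simpa [coe_aeval_eq_eval] using this)
      have hd := degree_eq_one_of_irreducible_of_root hirr hr
      obtain ⟨a, ha⟩ := minpoly.mem_range_of_degree_eq_one F x hd
      exact hxF (ha ▸ a.2)
    rw [← eval_map_algebraMap]
    refine Polynomial.eval_nonneg_of_frequently (Eventually.frequently ?_)
    have hpm : p.map (algebraMap F ℝ) ≠ 0 := by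
      rwa [Ne, Polynomial.map_eq_zero]
    have hfin : ∀ᶠ z in nhdsWithin y {y}ᶜ, ¬ (p.map (algebraMap F ℝ)).IsRoot z :=
      nhdsNE_le_cofinite y (finite_setOfPred_isRoot hpm).compl_mem_cofinite
    filter_upwards [hfin, mem_nhdsWithin_of_mem_nhds (hint y hy hyF)] with z hz hzM
    rw [eval_map_algebraMap]
    exact hquot z hzM (by rwa [IsRoot, eval_map_algebraMap] at hz)
  · exact hquot y hy hpy

/-- The product may vanish at boundary points, so it cannot itself be perturbed freely. Only the
zero-free factor `h` is perturbed, and the roots of the fixed factor are retained through the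
multiplicities in `RootApprox`. -/
theorem prod_X_sub_C_mul_mem_genPreordering (hM : IsClosed M) (hne : M.Nonempty)
    (hF : frontier M ⊆ (F : Set ℝ)) (s : Multiset F) {h : Polynomial F}
    (hf : (s.map fun a => X - C a).prod * h ∈ posPoly F M) (hz : ∀ x ∈ M, aeval x h ≠ 0) :
    (s.map fun a => X - C a).prod * h ∈ genPreordering F (naturalGenerators F M) := by
  set Z : Polynomial F := (s.map fun a => X - C a).prod with hZ
  set E := h.natDegree with hE
  set hR := h.map (algebraMap F ℝ) with hhR
  have hZR : Z.map (algebraMap F ℝ) = (s.map fun a : F => X - C (a : ℝ)).prod := by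
    rw [hZ, Polynomial.map_multiset_prod, Multiset.map_map]
    congr 2
    funext a
    simp
    rfl
  have hZmonic : Z.Monic := monic_multiset_prod_of_monic _ _ fun a _ => monic_X_sub_C a
  have hER : hR.natDegree = E := natDegree_map _
  obtain ⟨x₀, hx₀⟩ := id hne
  have hh0 : h ≠ 0 := by
    rintro rfl
    exact hz x₀ hx₀ (map_zero _)
  have hR0 : hR ≠ 0 := by rwa [hhR, Ne, Polynomial.map_eq_zero]
  obtain ⟨δ, hδ, hpert⟩ := Polynomial.exists_coeff_perturbation hM hR0
    fun x hx => by rw [hhR, eval_map_algebraMap]; exact hz x hx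
  rw [hER] at hpert
  set A : Set (Fin (E + 1) → F) := {v | ∃ k : Polynomial F, k.natDegree ≤ E ∧
    Z * k ∈ genPreordering F (naturalGenerators F M) ∧ ∀ i : Fin (E + 1), v i = k.coeff i}
  have hmem : (fun i : Fin (E + 1) => (h.coeff i : ℝ)) ∈
      convexHull ℝ ((fun (v : Fin (E + 1) → F) i => (v i : ℝ)) '' A) := by
    refine Convex.mem_of_closure_mem_nhds (convex_convexHull ℝ _)
      (mem_of_superset (Metric.ball_mem_nhds _ hδ) ?_)
    refine Subset.trans ?_ (closure_mono (subset_convexHull ℝ _))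
    -- It is enough that each real vector `v` close to the coefficients of `h` is a limit of members
    -- of `A`.
    intro v hv
    set q := Polynomial.ofFn (E + 1) v with hq
    have hqdeg : q.natDegree ≤ E := Nat.lt_succ_iff.1 (ofFn_natDegree_lt (by omega) v)
    have hqc : ∀ i : Fin (E + 1), q.coeff i = v i := fun i =>
      ofFn_coeff_eq_val_of_lt v i.2
    have hsign := hpert q hqdeg fun k hk => by
      have := (dist_pi_lt_iff hδ).1 (Metric.mem_ball.1 hv) ⟨k, Nat.lt_succ_of_le hk⟩
      rw [Real.dist_eq, ← hqc] at this
      rwa [hhR, Polynomial.coeff_map]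
    have hq0 : q ≠ 0 := fun h0 => by
      have := hsign x₀ hx₀
      simp [h0] at this
    have hZ0 : (s.map fun a : F => X - C (a : ℝ)).prod ≠ 0 := by
      rw [← hZR]
      exact (hZmonic.map _).ne_zero
    obtain ⟨p, hp, hpT⟩ := exists_rootApprox_mem_genPreordering hM hne hF _
      ((s.map fun a : F => X - C (a : ℝ)).prod * q) le_rfl (mul_ne_zero hZ0 hq0) fun x hx => by
        have h1 := hf x hx
        have h2 := hsign x hx
        rw [map_mul, ← eval_map_algebraMap, ← eval_map_algebraMap, ← hhR, hZR] at h1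
        rw [eval_mul]
        have h3 : hR.eval x ≠ 0 := right_ne_zero_of_mul h2.ne'
        have h4 : 0 < hR.eval x ^ 2 := by positivity
        -- The values satisfy `(Z q) h² = (Z h)(q h)`, where the right side is nonnegative and `h²`
        -- is positive.
        refine nonneg_of_mul_nonneg_left (b := hR.eval x ^ 2) ?_ h4
        nlinarith [mul_nonneg h1 h2.le]
    choose k hk using fun n => hp.prod_X_sub_C_dvd n
    have hkdeg : ∀ n, (k n).natDegree ≤ E := fun n => by
      have h1 := hp.natDegree_le n
      by_cases hk0 : k n = 0
      · simp [hk0]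
      rw [hk n, ← hZ, hZmonic.natDegree_mul' hk0, natDegree_mul hZ0 hq0, ← hZR, natDegree_map] at h1
      omega
    have hlim : ∀ j, Tendsto (fun n => ((k n).coeff j : ℝ)) atTop (nhds (q.coeff j)) := fun j => by
      have hs : (s.map fun a : F => X - C (a : ℝ)) =
          (s.map (fun a : F => (a : ℝ))).map fun a => X - C a := by
        rw [Multiset.map_map]; rfl
      have key := Polynomial.tendsto_coeff_of_prod_X_sub_C_mul (s.map (fun a : F => (a : ℝ)))
        (p := fun n => (k n).map (algebraMap F ℝ)) (N := E)
        (fun n => natDegree_map_le.trans (hkdeg n)) hqdeg (fun i => by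
          rw [← hs]
          refine (hp.tendsto i).congr fun n => ?_
          rw [hk n, ← hZR, ← Polynomial.map_mul, Polynomial.coeff_map]
          rfl) j
      refine key.congr fun n => ?_
      rw [Polynomial.coeff_map]
      rfl
    refine mem_closure_of_tendsto (f := fun n (i : Fin (E + 1)) => ((k n).coeff i : ℝ)) (b := atTop)
      (tendsto_pi_nhds.2 fun i => hqc i ▸ hlim i) (Eventually.of_forall fun n => ?_)
    exact ⟨fun i => (k n).coeff i, ⟨k n, hkdeg n, by rw [hZ, ← hk n]; exact hpT n, fun _ => rfl⟩, rfl⟩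
  obtain ⟨κ, _, z, w, hzA, hw, hwz⟩ := exists_convex_combination_over_subfield F hmem
  choose k hkdeg hkT hkc using hzA
  have hsum : h = ∑ j, C (w j) * k j := by
    ext i
    rw [finsetSum_coeff]
    congr 1
    by_cases hi : i < E + 1
    · have := congrFun hwz ⟨i, hi⟩
      simp only [Finset.sum_apply, Pi.smul_apply, smul_eq_mul, hkc] at this
      rw [← this]
      simp
    · rw [coeff_eq_zero_of_natDegree_lt (by omega)]
      refine (Finset.sum_eq_zero fun j _ => ?_).symm
      rw [coeff_C_mul, coeff_eq_zero_of_natDegree_lt (by have := hkdeg j; omega), mul_zero]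
  rw [hsum, Finset.mul_sum]
  refine sum_mem_genPreordering fun j _ => ?_
  rw [mul_left_comm]
  exact mul_mem_genPreordering (C_mem_genPreordering (hw j)) (hkT j)

/-- The natural generators of a closed set with boundary in `F` generate a saturated
preordering. -/
theorem genPreordering_naturalGenerators (hM : IsClosed M) (hne : M.Nonempty)
    (hF : frontier M ⊆ (F : Set ℝ)) :
    genPreordering F (naturalGenerators F M) = posPoly F M := by
  refine Subset.antisymm (genPreordering_subset_posPoly naturalGenerators_subset_posPoly) ?_
  suffices ∀ N, ∀ f : Polynomial F, f.natDegree < N → f ∈ posPoly F M →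
      f ∈ genPreordering F (naturalGenerators F M) from
    fun f hf => this _ f (Nat.lt_succ_self _) hf
  intro N
  induction N with
  | zero => exact fun f hf => absurd hf (Nat.not_lt_zero _)
  | succ N ih =>
    intro f hdeg hf
    by_cases hf0 : f = 0
    · rw [hf0]
      exact zero_mem_genPreordering
    by_cases hroots : ∃ x ∈ M, x ∉ F ∧ aeval x f = 0
    · obtain ⟨x, hx, hxF, hroot⟩ := hroots
      obtain ⟨p, h, hfp, hlt, hh⟩ := exists_sq_factor_of_root_notMem hF hf0 hf hx hxF hroot
      rw [hfp]
      exact mul_mem_genPreordering (sq_mem_genPreordering p) (ih h (by omega) hh)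
    -- All roots of `f` in `F` go into the product. A zero of `h` on `M` would then lie outside `F`,
    -- which this case excludes.
    · obtain ⟨h, hfh, -, hhr⟩ := exists_prod_multiset_X_sub_C_mul f
      have hh0 : h ≠ 0 := by
        rintro rfl
        exact hf0 (by rw [← hfh, mul_zero])
      rw [← hfh] at hf ⊢
      refine prod_X_sub_C_mul_mem_genPreordering hM hne hF _ hf fun x hx hxh => ?_
      by_cases hxF : x ∈ F
      · have hr : h.IsRoot ⟨x, hxF⟩ := by
          have : aeval (algebraMap F ℝ ⟨x, hxF⟩) h = 0 := hxh
          rw [aeval_algebraMap_apply] at this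
          exact (algebraMap F ℝ).injective (by simpa [coe_aeval_eq_eval] using this)
        have := (mem_roots hh0).2 hr
        rw [hhr] at this
        exact Multiset.notMem_zero _ this
      · refine hroots ⟨x, hx, hxF, ?_⟩
        rw [← hfh, map_mul, hxh, mul_zero]

end Saturation

/-! ### Closed sets with finite boundary in `F`. -/

section Tame

/-- A closed set with finite boundary contained in `F`. -/
structure IsTame (F : Subfield ℝ) (M : Set ℝ) : Prop where
  isClosed : IsClosed M
  finite_frontier : (frontier M).Finite
  frontier_subset : frontier M ⊆ (F : Set ℝ)

variable {F : Subfield ℝ}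

theorem IsTame.union {A B : Set ℝ} (hA : IsTame F A) (hB : IsTame F B) : IsTame F (A ∪ B) := by
  have h : frontier (A ∪ B) ⊆ frontier A ∪ frontier B :=
    (frontier_union_subset A B).trans (union_subset_union inter_subset_left inter_subset_right)
  exact ⟨hA.isClosed.union hB.isClosed, (hA.finite_frontier.union hB.finite_frontier).subset h,
    h.trans (union_subset hA.frontier_subset hB.frontier_subset)⟩

theorem isTame_empty : IsTame F ∅ := ⟨isClosed_empty, by simp, by simp⟩

theorem IsTame.biUnion {ι : Type*} {s : Set ι} (hs : s.Finite) {A : ι → Set ℝ}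
    (hA : ∀ i, IsTame F (A i)) : IsTame F (⋃ i ∈ s, A i) := by
  induction s, hs using Set.Finite.induction_on with
  | empty => simpa using isTame_empty
  | insert _ _ ih =>
    rw [biUnion_insert]
    exact (hA _).union ih

theorem isTame_Ici (a : F) : IsTame F (Ici (a : ℝ)) :=
  ⟨isClosed_Ici, by rw [frontier_Ici]; exact finite_singleton _, by
    rw [frontier_Ici]; exact singleton_subset_iff.2 a.2⟩

theorem isTame_Iic (a : F) : IsTame F (Iic (a : ℝ)) :=
  ⟨isClosed_Iic, by rw [frontier_Iic]; exact finite_singleton _, by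
    rw [frontier_Iic]; exact singleton_subset_iff.2 a.2⟩

theorem isTame_Icc (a b : F) : IsTame F (Icc (a : ℝ) b) := by
  rcases le_or_gt (a : ℝ) b with h | h
  · refine ⟨isClosed_Icc, ?_, ?_⟩ <;> rw [frontier_Icc h]
    · exact toFinite _
    · rintro x (rfl | rfl)
      exacts [a.2, b.2]
  · rw [Icc_eq_empty (not_le.2 h)]
    exact isTame_empty

end Tame

/-! ### Filters along which polynomials have a definite sign. -/

section DefiniteFilter

/-- A filter on the real line along which every real polynomial has a definite sign, for the
reason that it avoids finite sets and has a basis of intervals. -/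
structure IsDefiniteFilter (l : Filter ℝ) : Prop where
  le_cofinite : l ≤ cofinite
  exists_isPreconnected : ∀ U ∈ l, ∃ V ∈ l, V ⊆ U ∧ IsPreconnected V

theorem isDefiniteFilter_atTop : IsDefiniteFilter atTop where
  le_cofinite := atTop_le_cofinite
  exists_isPreconnected U hU := by
    obtain ⟨R, hR⟩ := mem_atTop_sets.1 hU
    exact ⟨Ici R, Ici_mem_atTop R, hR, isPreconnected_Ici⟩

theorem isDefiniteFilter_atBot : IsDefiniteFilter atBot where
  le_cofinite := atBot_le_cofinite
  exists_isPreconnected U hU := by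
    obtain ⟨R, hR⟩ := mem_atBot_sets.1 hU
    exact ⟨Iic R, Iic_mem_atBot R, hR, isPreconnected_Iic⟩

theorem isDefiniteFilter_nhdsGT (a : ℝ) : IsDefiniteFilter (nhdsWithin a (Ioi a)) where
  le_cofinite := (nhdsWithin_mono a fun x hx => ne_of_gt (mem_Ioi.1 hx)).trans (nhdsNE_le_cofinite a)
  exists_isPreconnected U hU := by
    obtain ⟨u, hu, hs⟩ := mem_nhdsGT_iff_exists_Ioo_subset.1 hU
    exact ⟨Ioo a u, Ioo_mem_nhdsGT hu, hs, isPreconnected_Ioo⟩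

variable {l : Filter ℝ}

/-- Some connected member of the filter avoids the roots of `p`, and there the intermediate value
theorem forbids a change of sign. -/
theorem IsDefiniteFilter.eventually_pos_or_nonpos (hl : IsDefiniteFilter l) (p : Polynomial ℝ) :
    (∀ᶠ x in l, 0 < p.eval x) ∨ ∀ᶠ x in l, p.eval x ≤ 0 := by
  by_cases hp : p = 0
  · exact Or.inr (by simp [hp])
  obtain ⟨V, hV, hVr, hVc⟩ := hl.exists_isPreconnected _
    (hl.le_cofinite (finite_setOfPred_isRoot hp).compl_mem_cofinite)
  by_cases h : ∃ x ∈ V, 0 < p.eval x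
  · obtain ⟨x, hx, hpx⟩ := h
    refine Or.inl (mem_of_superset hV fun y hy => ?_)
    by_contra hpy
    obtain ⟨z, hz, hz0⟩ := hVc.intermediate_value hy hx p.continuous.continuousOn
      ⟨not_lt.1 hpy, hpx.le⟩
    exact hVr hz hz0
  · exact Or.inr (mem_of_superset hV fun y hy => not_lt.1 fun hpy => h ⟨y, hy, hpy⟩)

theorem IsDefiniteFilter.eventually_nonneg (hl : IsDefiniteFilter l) {p : Polynomial ℝ}
    (h : ∃ᶠ x in l, 0 ≤ p.eval x) : ∀ᶠ x in l, 0 ≤ p.eval x := by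
  rcases hl.eventually_pos_or_nonpos (-p) with h1 | h1
  · refine absurd h (not_frequently.2 ?_)
    filter_upwards [h1] with x hx
    simpa using hx
  · filter_upwards [h1] with x hx
    simpa using hx

/-- The sets decided by the filter are closed under complements and unions, and contain the
generating sets. -/
theorem IsSemialgebraicSet.eventually_mem_or_notMem (hl : IsDefiniteFilter l) {A : Set ℝ}
    (hA : IsSemialgebraicSet A) : (∀ᶠ x in l, x ∈ A) ∨ ∀ᶠ x in l, x ∉ A := by
  induction hA with
  | pos p =>
    rcases hl.eventually_pos_or_nonpos p with h | h
    · exact Or.inl h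
    · exact Or.inr (h.mono fun x hx => not_lt.2 hx)
  | compl A _ ih =>
    rcases ih with h | h
    · exact Or.inr (h.mono fun x hx hx' => hx' hx)
    · exact Or.inl h
  | union A B _ _ ihA ihB =>
    rcases ihA with h | h
    · exact Or.inl (h.mono fun x hx => Or.inl hx)
    · rcases ihB with h' | h'
      · exact Or.inl (h'.mono fun x hx => Or.inr hx)
      · exact Or.inr ((h.and h').mono fun x hx hx' => hx'.elim hx.1 hx.2)

end DefiniteFilter

/-! ### Consequences of a tame approximation. -/

section Approximation

/-- A strictly decreasing sequence of tame sets that contain `K` and differ from it only far out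
along two filters (possibly the same), along which `K` does not stop; along the first filter
the complement of `K` does not stop either. -/
structure IsTameApproximation (F : Subfield ℝ) (K : Set ℝ) (L : ℕ → Set ℝ) : Prop where
  isTame : ∀ n, IsTame F (L n)
  nonempty : K.Nonempty
  subset : ∀ n, K ⊆ L n
  succ_subset : ∀ n, L (n + 1) ⊆ L n
  not_subset_succ : ∀ n, ∃ x ∈ L n, x ∉ L (n + 1)
  exists_filters : ∃ l₁ l₂ : Filter ℝ, IsDefiniteFilter l₁ ∧ IsDefiniteFilter l₂ ∧
    (∃ᶠ x in l₁, x ∈ K) ∧ (∃ᶠ x in l₂, x ∈ K) ∧ (∃ᶠ x in l₁, x ∉ K) ∧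
      ∀ U ∈ l₁, ∀ V ∈ l₂, ∃ n, L n ⊆ K ∪ U ∪ V

variable {F : Subfield ℝ} {K : Set ℝ} {L : ℕ → Set ℝ}

theorem posPoly_antitone {A B : Set ℝ} (h : A ⊆ B) : posPoly F B ⊆ posPoly F A :=
  fun _ hf x hx => hf x (h hx)

theorem IsTameApproximation.posPoly_eq (h : IsTameApproximation F K L) :
    posPoly F K = ⋃ n, posPoly F (L n) := by
  refine Subset.antisymm (fun f hf => ?_) (iUnion_subset fun n => posPoly_antitone (h.subset n))
  obtain ⟨l₁, l₂, hl₁, hl₂, hK₁, hK₂, -, hL⟩ := h.exists_filters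
  have hf' : ∀ x ∈ K, 0 ≤ (f.map (algebraMap F ℝ)).eval x := fun x hx => by
    rw [eval_map_algebraMap]
    exact hf x hx
  obtain ⟨n, hn⟩ := hL _ (hl₁.eventually_nonneg (hK₁.mono hf')) _
    (hl₂.eventually_nonneg (hK₂.mono hf'))
  refine mem_iUnion.2 ⟨n, fun x hx => ?_⟩
  rw [← eval_map_algebraMap]
  rcases hn hx with (hx | hx) | hx
  exacts [hf' x hx, hx, hx]

theorem IsTameApproximation.not_isSemialgebraicSet (h : IsTameApproximation F K L) :
    ¬ IsSemialgebraicSet K := by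
  intro hK
  obtain ⟨l₁, -, hl₁, -, hK₁, -, hK₂, -⟩ := h.exists_filters
  rcases hK.eventually_mem_or_notMem hl₁ with h1 | h1
  · exact hK₂ (h1.mono fun x hx hx' => hx' hx)
  · exact hK₁ h1

theorem IsTameApproximation.basicClosedSet_eq (h : IsTameApproximation F K L) (n : ℕ) :
    basicClosedSet F (naturalGenerators F (L n)) = L n :=
  basicClosedSet_naturalGenerators (h.isTame n).isClosed (h.nonempty.mono (h.subset n))
    (h.isTame n).frontier_subset

theorem IsTameApproximation.not_isFinitelyGeneratedPreordering (h : IsTameApproximation F K L) :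
    ¬ IsFinitelyGeneratedPreordering F (posPoly F K) := by
  rintro ⟨S, hS⟩
  have hanti : Antitone L := antitone_nat_of_succ_le h.succ_subset
  have hmono : Monotone fun n => posPoly F (L n) := fun m n hmn => posPoly_antitone (hanti hmn)
  have hSK : (S : Set (Polynomial F)) ⊆ ⋃ n, posPoly F (L n) := by
    rw [← h.posPoly_eq, hS]
    exact subset_genPreordering
  -- A finite set inside an increasing union lies in one member, so everything generated by `S` is
  -- nonnegative on `L n`. The generators of `L (n + 1)` are among it, which forces `L n ⊆ L (n +
  -- 1)`.
  obtain ⟨n, hn⟩ := hmono.directed_le.exists_mem_subset_of_finset_subset_biUnion hSK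
  obtain ⟨x, hx, hx'⟩ := h.not_subset_succ n
  refine hx' ?_
  rw [← h.basicClosedSet_eq]
  intro g hg
  have hgK : g ∈ posPoly F K :=
    posPoly_antitone (h.subset _) (naturalGenerators_subset_posPoly hg)
  rw [hS] at hgK
  exact genPreordering_subset_posPoly hn hgK x hx

end Approximation

/-! ### The concrete families of sets. -/

section Cases

variable {F : Subfield ℝ}

/-- The set `B` is the component of index `0`, bounded or a half-line, so both variants are treated
at once. -/
theorem isTameApproximation_right {α β : ℕ → F} {B : Set ℝ} (hB : IsTame F B)
    (hBβ : B ⊆ Iic (β 0 : ℝ)) (hle : ∀ i, 1 ≤ i → (α i : ℝ) ≤ β i)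
    (hlt : ∀ i, (β i : ℝ) < α (i + 1)) (hα : Tendsto (fun i => (α i : ℝ)) atTop atTop)
    (hβ : Tendsto (fun i => (β i : ℝ)) atTop atTop) :
    IsTameApproximation F (B ∪ ⋃ i : ℕ, ⋃ _ : 1 ≤ i, Icc (α i : ℝ) (β i))
      (fun n => B ∪ (⋃ i : ℕ, ⋃ _ : 1 ≤ i ∧ i ≤ n, Icc (α i : ℝ) (β i)) ∪
        Ici (α (n + 1) : ℝ)) := by
  have hβα : ∀ i j, i < j → (β i : ℝ) < α j := fun i j hij => by
    induction j, hij using Nat.le_induction with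
    | base => exact hlt i
    | succ j hj ih => exact (ih.trans_le (hle j (by omega))).trans (hlt j)
  have hβm : ∀ i j, i ≤ j → (β i : ℝ) ≤ β j := fun i j hij => by
    rcases hij.eq_or_lt with rfl | h
    · rfl
    · exact (hβα i j h).le.trans (hle j (by omega))
  have hαm : ∀ i j, 1 ≤ i → i ≤ j → (α i : ℝ) ≤ α j := fun i j hi hij => by
    rcases hij.eq_or_lt with rfl | h
    · rfl
    · exact (hle i hi).trans (hβα i j h).le
  have hgap : ∀ n x, (β n : ℝ) < x → x < α (n + 1) →
      x ∉ B ∪ ⋃ i : ℕ, ⋃ _ : 1 ≤ i, Icc (α i : ℝ) (β i) := by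
    intro n x h1 h2
    simp only [mem_union, mem_iUnion, mem_Icc, exists_prop, not_or, not_exists, not_and, not_le]
    refine ⟨fun hx => ?_, fun i hi hx => ?_⟩
    · have := mem_Iic.1 (hBβ hx)
      linarith [hβm 0 n (Nat.zero_le n)]
    · rcases le_or_gt i n with h | h
      · exact (hβm i n h).trans_lt h1
      · linarith [hαm (n + 1) i (by omega) h]
  -- Midpoints of the gaps witness both that the complement of `K` recurs and that the
  -- approximations strictly decrease.
  have hmid : ∀ n, (β n : ℝ) < (β n + α (n + 1)) / 2 ∧ ((β n : ℝ) + α (n + 1)) / 2 < α (n + 1) :=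
    fun n => ⟨by linarith [hlt n], by linarith [hlt n]⟩
  refine ⟨fun n => ?_, ⟨α 1, ?_⟩, fun n => ?_, fun n => ?_, fun n => ?_, ?_⟩
  · exact (hB.union (IsTame.biUnion (finite_Icc 1 n) fun i => isTame_Icc (α i) (β i))).union
      (isTame_Ici _)
  · simp only [mem_union, mem_iUnion, mem_Icc, exists_prop]
    exact Or.inr ⟨1, le_rfl, le_rfl, hle 1 le_rfl⟩
  · intro x
    simp only [mem_union, mem_iUnion, mem_Icc, mem_Ici, exists_prop]
    rintro (hx | ⟨i, hi, h1, h2⟩)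
    · exact Or.inl (Or.inl hx)
    · rcases le_or_gt i n with h | h
      · exact Or.inl (Or.inr ⟨i, ⟨hi, h⟩, h1, h2⟩)
      · exact Or.inr ((hαm (n + 1) i (by omega) h).trans h1)
  · intro x
    simp only [mem_union, mem_iUnion, mem_Icc, mem_Ici, exists_prop]
    rintro ((hx | ⟨i, ⟨hi, hin⟩, h1, h2⟩) | hx)
    · exact Or.inl (Or.inl hx)
    · rcases le_or_gt i n with h | h
      · exact Or.inl (Or.inr ⟨i, ⟨hi, h⟩, h1, h2⟩)
      · exact Or.inr ((hαm (n + 1) i (by omega) h).trans h1)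
    · exact Or.inr ((hαm (n + 1) (n + 1 + 1) (by omega) (by omega)).trans hx)
  · obtain ⟨h1, h2⟩ := hmid (n + 1)
    refine ⟨_, Or.inr ((hle (n + 1) (by omega)).trans h1.le), fun hx => ?_⟩
    have hK := hgap _ _ h1 h2
    simp only [mem_union, mem_iUnion, mem_Ici, exists_prop] at hx hK
    rcases hx with (hx | ⟨i, hi, hx⟩) | hx
    · exact hK (Or.inl hx)
    · exact hK (Or.inr ⟨i, hi.1, hx⟩)
    · exact absurd h2 (not_lt.2 hx)
  · have hK : ∃ᶠ x in atTop, x ∈ B ∪ ⋃ i : ℕ, ⋃ _ : 1 ≤ i, Icc (α i : ℝ) (β i) := by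
      refine hα.frequently (Eventually.frequently ?_)
      filter_upwards [eventually_ge_atTop 1] with i hi
      exact Or.inr (mem_iUnion₂.2 ⟨i, hi, le_rfl, hle i hi⟩)
    refine ⟨atTop, atTop, isDefiniteFilter_atTop, isDefiniteFilter_atTop, hK, hK, ?_, ?_⟩
    · exact (tendsto_atTop_mono (fun n => (hmid n).1.le) hβ).frequently
        (Eventually.of_forall fun n => hgap n _ (hmid n).1 (hmid n).2).frequently
    · intro U hU V _
      obtain ⟨R, hR⟩ := mem_atTop_sets.1 hU
      obtain ⟨n, hn⟩ := ((hα.comp (tendsto_add_atTop_nat 1)).eventually_ge_atTop R).exists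
      refine ⟨n, ?_⟩
      rintro x ((hx | hx) | hx)
      · exact Or.inl (Or.inl (Or.inl hx))
      · obtain ⟨i, hi, hx⟩ := mem_iUnion₂.1 hx
        exact Or.inl (Or.inl (Or.inr (mem_iUnion₂.2 ⟨i, hi.1, hx⟩)))
      · exact Or.inl (Or.inr (hR x (hn.trans hx)))

theorem isTameApproximation_left {α β : ℤ → F} {B : Set ℝ} (hB : IsTame F B)
    (hBα : B ⊆ Ici (α 0 : ℝ)) (hle : ∀ i, i < 0 → (α i : ℝ) ≤ β i)
    (hlt : ∀ i, i < 0 → (β i : ℝ) < α (i + 1)) (hα : Tendsto (fun i => (α i : ℝ)) atBot atBot)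
    (hβ : Tendsto (fun i => (β i : ℝ)) atBot atBot) :
    IsTameApproximation F ((⋃ i : ℤ, ⋃ _ : i < 0, Icc (α i : ℝ) (β i)) ∪ B)
      (fun n => Iic (β (-((n : ℤ) + 1)) : ℝ) ∪
        (⋃ i : ℤ, ⋃ _ : -(n : ℤ) ≤ i ∧ i < 0, Icc (α i : ℝ) (β i)) ∪ B) := by
  have hβα : ∀ i j, i < j → j ≤ 0 → (β i : ℝ) < α j := fun i j hij => by
    induction j, hij using Int.leInduction with
    | base => exact fun hj => hlt i (by omega)
    | succ j hj ih =>
      intro hj'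
      exact ((ih (by omega)).trans_le (hle j (by omega))).trans (hlt j (by omega))
  have hβm : ∀ i j, i ≤ j → j < 0 → (β i : ℝ) ≤ β j := fun i j hij hj => by
    rcases hij.eq_or_lt with rfl | h
    · rfl
    · exact (hβα i j h hj.le).le.trans (hle j hj)
  have hαm : ∀ i j, i ≤ j → j ≤ 0 → (α i : ℝ) ≤ α j := fun i j hij hj => by
    rcases hij.eq_or_lt with rfl | h
    · rfl
    · exact (hle i (by omega)).trans (hβα i j h hj).le
  have hgap : ∀ n x, n < 0 → (β n : ℝ) < x → x < α (n + 1) →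
      x ∉ (⋃ i : ℤ, ⋃ _ : i < 0, Icc (α i : ℝ) (β i)) ∪ B := by
    intro n x hn h1 h2
    simp only [mem_union, mem_iUnion, mem_Icc, exists_prop, not_or, not_exists, not_and, not_le]
    refine ⟨fun i hi hx => ?_, fun hx => ?_⟩
    · rcases le_or_gt i n with h | h
      · exact (hβm i n h hn).trans_lt h1
      · linarith [hαm (n + 1) i h hi.le]
    · have := mem_Ici.1 (hBα hx)
      linarith [hαm (n + 1) 0 (by omega) le_rfl]
  have hmid : ∀ n, n < 0 →
      (β n : ℝ) < (β n + α (n + 1)) / 2 ∧ ((β n : ℝ) + α (n + 1)) / 2 < α (n + 1) :=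
    fun n hn => ⟨by linarith [hlt n hn], by linarith [hlt n hn]⟩
  refine ⟨fun n => ?_, ⟨α (-1), ?_⟩, fun n => ?_, fun n => ?_, fun n => ?_, ?_⟩
  · exact ((isTame_Iic _).union
      (IsTame.biUnion (finite_Ico (-(n : ℤ)) 0) fun i => isTame_Icc (α i) (β i))).union hB
  · exact Or.inl (mem_iUnion₂.2 ⟨-1, by norm_num, le_rfl, hle (-1) (by norm_num)⟩)
  · intro x
    simp only [mem_union, mem_iUnion, mem_Icc, mem_Iic, exists_prop]
    rintro (⟨i, hi, h1, h2⟩ | hx)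
    · rcases le_or_gt (-(n : ℤ)) i with h | h
      · exact Or.inl (Or.inr ⟨i, ⟨h, hi⟩, h1, h2⟩)
      · exact Or.inl (Or.inl (h2.trans (hβm i _ (by omega) (by omega))))
    · exact Or.inr hx
  · intro x
    simp only [mem_union, mem_iUnion, mem_Icc, mem_Iic, exists_prop]
    push_cast
    rintro ((hx | ⟨i, ⟨hin, hi⟩, h1, h2⟩) | hx)
    · exact Or.inl (Or.inl (hx.trans (hβm _ _ (by omega) (by omega))))
    · rcases le_or_gt (-(n : ℤ)) i with h | h
      · exact Or.inl (Or.inr ⟨i, ⟨h, hi⟩, h1, h2⟩)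
      · exact Or.inl (Or.inl (h2.trans (hβm i _ (by omega) (by omega))))
    · exact Or.inr hx
  -- This gap lies inside the half-line of `L n`, which ends at index `-(n + 1)`, and just beyond
  -- that of `L (n + 1)`, which ends at `-(n + 2)`.
  · obtain ⟨h1, h2⟩ := hmid (-((n : ℤ) + 2)) (by omega)
    refine ⟨((β (-((n : ℤ) + 2)) : ℝ) + α (-((n : ℤ) + 2) + 1)) / 2, Or.inl (Or.inl ?_),
      fun hx => ?_⟩
    · have e : -((n : ℤ) + 2) + 1 = -(n + 1) := by ring
      rw [mem_Iic]
      refine h2.le.trans ?_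
      rw [e]
      exact hle _ (by omega)
    · have hK := hgap _ _ (by omega) h1 h2
      simp only [mem_union, mem_iUnion, mem_Iic, exists_prop] at hx hK
      rcases hx with (hx | ⟨i, hi, hx⟩) | hx
      · have e : -(((n + 1 : ℕ) : ℤ) + 1) = -((n : ℤ) + 2) := by push_cast; ring
        rw [e] at hx
        exact absurd h1 (not_lt.2 hx)
      · exact hK (Or.inl ⟨i, hi.2, hx⟩)
      · exact hK (Or.inr hx)
  · have hK : ∃ᶠ x in atBot, x ∈ (⋃ i : ℤ, ⋃ _ : i < 0, Icc (α i : ℝ) (β i)) ∪ B := by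
      refine hα.frequently (Eventually.frequently ?_)
      filter_upwards [eventually_lt_atBot 0] with i hi
      exact Or.inl (mem_iUnion₂.2 ⟨i, hi, le_rfl, hle i hi⟩)
    refine ⟨atBot, atBot, isDefiniteFilter_atBot, isDefiniteFilter_atBot, hK, hK, ?_, ?_⟩
    · refine (tendsto_atBot_mono' atBot ?_
        (hα.comp (tendsto_atBot_add_const_right atBot (1 : ℤ) tendsto_id))).frequently
        (f := fun n => ((β n : ℝ) + α (n + 1)) / 2) (Eventually.frequently ?_)
      · filter_upwards [eventually_lt_atBot 0] with n hn
        exact (hmid n hn).2.le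
      · filter_upwards [eventually_lt_atBot 0] with n hn
        exact hgap n _ hn (hmid n hn).1 (hmid n hn).2
    · intro U hU V _
      obtain ⟨R, hR⟩ := mem_atBot_sets.1 hU
      obtain ⟨m, hm⟩ := ((hβ.eventually_le_atBot R).and (eventually_lt_atBot 0)).exists
      refine ⟨m.natAbs, ?_⟩
      rintro x ((hx | hx) | hx)
      · exact Or.inl (Or.inr (hR x ((mem_Iic.1 hx).trans
          ((hβm _ m (by omega) hm.2).trans hm.1))))
      · obtain ⟨i, hi, hx⟩ := mem_iUnion₂.1 hx
        exact Or.inl (Or.inl (Or.inl (mem_iUnion₂.2 ⟨i, hi.2, hx⟩)))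
      · exact Or.inl (Or.inl (Or.inr hx))

theorem isTameApproximation_twoSided {α β : ℤ → F} (hle : ∀ i, (α i : ℝ) ≤ β i)
    (hlt : ∀ i, (β i : ℝ) < α (i + 1)) (hαr : Tendsto (fun i => (α i : ℝ)) atTop atTop)
    (hβr : Tendsto (fun i => (β i : ℝ)) atTop atTop)
    (hβl : Tendsto (fun i => (β i : ℝ)) atBot atBot) :
    IsTameApproximation F (⋃ i : ℤ, Icc (α i : ℝ) (β i))
      (fun n => (⋃ i : ℤ, ⋃ _ : -(n : ℤ) ≤ i ∧ i ≤ (n : ℤ), Icc (α i : ℝ) (β i)) ∪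
        Iic (β (-((n : ℤ) + 1)) : ℝ) ∪ Ici (α ((n : ℤ) + 1) : ℝ)) := by
  have hβα : ∀ i j, i < j → (β i : ℝ) < α j := fun i j hij => by
    induction j, hij using Int.leInduction with
    | base => exact hlt i
    | succ j hj ih => exact (ih.trans_le (hle j)).trans (hlt j)
  have hβm : ∀ i j, i ≤ j → (β i : ℝ) ≤ β j := fun i j hij => by
    rcases hij.eq_or_lt with rfl | h
    · rfl
    · exact (hβα i j h).le.trans (hle j)
  have hαm : ∀ i j, i ≤ j → (α i : ℝ) ≤ α j := fun i j hij => by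
    rcases hij.eq_or_lt with rfl | h
    · rfl
    · exact (hle i).trans (hβα i j h).le
  have hgap : ∀ n x, (β n : ℝ) < x → x < α (n + 1) → x ∉ ⋃ i : ℤ, Icc (α i : ℝ) (β i) := by
    intro n x h1 h2 hx
    obtain ⟨i, hx1, hx2⟩ := mem_iUnion.1 hx
    rcases le_or_gt i n with h | h
    · exact absurd ((hx2.trans (hβm i n h))) (not_le.2 h1)
    · linarith [hαm (n + 1) i h]
  have hmid : ∀ n, (β n : ℝ) < (β n + α (n + 1)) / 2 ∧ ((β n : ℝ) + α (n + 1)) / 2 < α (n + 1) :=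
    fun n => ⟨by linarith [hlt n], by linarith [hlt n]⟩
  have hcover : ∀ (n : ℕ) (i : ℤ) (x : ℝ), x ∈ Icc (α i : ℝ) (β i) →
      x ∈ (⋃ i : ℤ, ⋃ _ : -(n : ℤ) ≤ i ∧ i ≤ (n : ℤ), Icc (α i : ℝ) (β i)) ∪
        Iic (β (-((n : ℤ) + 1)) : ℝ) ∪ Ici (α ((n : ℤ) + 1) : ℝ) := by
    intro n i x hx
    rcases lt_or_ge i (-(n : ℤ)) with h | h
    · exact Or.inl (Or.inr (hx.2.trans (hβm _ _ (by omega))))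
    rcases le_or_gt i n with h' | h'
    · exact Or.inl (Or.inl (mem_iUnion₂.2 ⟨i, ⟨h, h'⟩, hx⟩))
    · exact Or.inr ((hαm _ _ (by omega)).trans hx.1)
  have hmem : ∀ i, (α i : ℝ) ∈ ⋃ i : ℤ, Icc (α i : ℝ) (β i) := fun i =>
    mem_iUnion.2 ⟨i, le_rfl, hle i⟩
  have hmem' : ∀ i, (β i : ℝ) ∈ ⋃ i : ℤ, Icc (α i : ℝ) (β i) := fun i =>
    mem_iUnion.2 ⟨i, hle i, le_rfl⟩
  refine ⟨fun n => ?_, ⟨α 0, hmem 0⟩, fun n x hx => ?_, fun n => ?_, fun n => ?_, ?_⟩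
  · exact ((IsTame.biUnion (finite_Icc (-(n : ℤ)) n) fun i => isTame_Icc (α i) (β i)).union
      (isTame_Iic _)).union (isTame_Ici _)
  · obtain ⟨i, hx⟩ := mem_iUnion.1 hx
    exact hcover n i x hx
  · rintro x ((hx | hx) | hx)
    · obtain ⟨i, -, hx⟩ := mem_iUnion₂.1 hx
      exact hcover n i x hx
    · exact Or.inl (Or.inr ((mem_Iic.1 hx).trans (hβm _ _ (by push_cast; omega))))
    · exact Or.inr ((hαm _ _ (by push_cast; omega)).trans (mem_Ici.1 hx))
  · obtain ⟨h1, h2⟩ := hmid ((n : ℤ) + 1)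
    refine ⟨_, Or.inr ((hle _).trans h1.le), ?_⟩
    rintro ((hx | hx) | hx)
    · obtain ⟨i, -, hx⟩ := mem_iUnion₂.1 hx
      exact hgap _ _ h1 h2 (mem_iUnion.2 ⟨i, hx⟩)
    · have h3 := hβm (-(((n + 1 : ℕ) : ℤ) + 1)) ((n : ℤ) + 1) (by push_cast; omega)
      exact absurd h1 (not_lt.2 ((mem_Iic.1 hx).trans h3))
    · have h3 : ((n + 1 : ℕ) : ℤ) + 1 = (n : ℤ) + 1 + 1 := by push_cast; ring
      rw [h3] at hx
      exact absurd h2 (not_lt.2 hx)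
  · refine ⟨atTop, atBot, isDefiniteFilter_atTop, isDefiniteFilter_atBot,
      hαr.frequently (Eventually.of_forall hmem).frequently,
      hβl.frequently (Eventually.of_forall hmem').frequently,
      (tendsto_atTop_mono (fun n => (hmid n).1.le) hβr).frequently
        (Eventually.of_forall fun n => hgap n _ (hmid n).1 (hmid n).2).frequently, ?_⟩
    intro U hU V hV
    obtain ⟨R, hR⟩ := mem_atTop_sets.1 hU
    obtain ⟨S, hS⟩ := mem_atBot_sets.1 hV
    obtain ⟨m, hm⟩ := (hαr.eventually_ge_atTop R).exists
    obtain ⟨k, hk⟩ := (hβl.eventually_le_atBot S).exists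
    -- One index must pass `m` on the right and `k` on the left.
    refine ⟨m.natAbs + k.natAbs, ?_⟩
    rintro x ((hx | hx) | hx)
    · obtain ⟨i, -, hx⟩ := mem_iUnion₂.1 hx
      exact Or.inl (Or.inl (mem_iUnion.2 ⟨i, hx⟩))
    · exact Or.inr (hS x ((mem_Iic.1 hx).trans ((hβm _ k (by omega)).trans hk)))
    · exact Or.inl (Or.inr (hR x (hm.trans ((hαm m _ (by omega)).trans
        (mem_Ici.1 hx)))))

theorem isTameApproximation_reciprocals :
    IsTameApproximation F ({0} ∪ {x : ℝ | ∃ i : ℕ, 1 ≤ i ∧ x = 1 / (i : ℝ)})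
      (fun n => Icc (0 : ℝ) (1 / ((n : ℝ) + 1)) ∪
        {x : ℝ | ∃ i : ℕ, 1 ≤ i ∧ i ≤ n ∧ x = 1 / (i : ℝ)}) := by
  have hle : ∀ n i : ℕ, n < i → (1 : ℝ) / i ≤ 1 / ((n : ℝ) + 1) := fun n i h =>
    one_div_le_one_div_of_le (by positivity) (by exact_mod_cast h)
  -- The point `1 / (n + 3/2)` lies between `1 / (n + 2)` and `1 / (n + 1)`; equality with some `1 /
  -- i` would give `2n + 3 = 2i`, against parity.
  have hgap : ∀ n i : ℕ, (1 : ℝ) / ((n : ℝ) + 3 / 2) ≠ 1 / (i : ℝ) := fun n i h => by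
    have h1 : (n : ℝ) + 3 / 2 = i := by
      rw [one_div, one_div] at h
      exact inv_injective h
    have h2 : 2 * n + 3 = 2 * i := by
      have : (2 : ℝ) * n + 3 = 2 * i := by linarith
      exact_mod_cast this
    omega
  have hpos : ∀ n : ℕ, (0 : ℝ) < 1 / ((n : ℝ) + 3 / 2) := fun n => by positivity
  have hnot : ∀ n : ℕ, (1 : ℝ) / ((n : ℝ) + 3 / 2) ∉
      ({0} ∪ {x : ℝ | ∃ i : ℕ, 1 ≤ i ∧ x = 1 / (i : ℝ)} : Set ℝ) := by
    rintro n (h | ⟨i, -, h⟩)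
    · exact (hpos n).ne' h
    · exact hgap n i h
  have hlim := tendsto_one_div_add_atTop_nhds_zero_nat (𝕜 := ℝ)
  refine ⟨fun n => ?_, ⟨0, Or.inl rfl⟩, fun n => ?_, fun n => ?_, fun n => ?_, ?_⟩
  · have h1 := isTame_Icc (0 : F) (1 / ((n : F) + 1))
    -- The isolated points are treated as degenerate intervals.
    have h2 := IsTame.biUnion (finite_Icc 1 n) fun i : ℕ => isTame_Icc (1 / (i : F)) (1 / (i : F))
    push_cast at h1 h2
    refine h1.union ?_
    convert! h2 using 1
    ext x
    simp only [Icc_self, mem_iUnion, mem_singleton_iff, exists_prop, mem_Icc]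
    exact exists_congr fun i => (and_assoc).symm
  · rintro x (hx | ⟨i, hi, rfl⟩)
    · rw [mem_singleton_iff.1 hx]
      exact Or.inl ⟨le_rfl, by positivity⟩
    · rcases le_or_gt i n with h | h
      · exact Or.inr ⟨i, hi, h, rfl⟩
      · exact Or.inl ⟨by positivity, hle n i h⟩
  · rintro x (hx | ⟨i, hi, -, rfl⟩)
    · refine Or.inl ⟨hx.1, hx.2.trans ?_⟩
      exact_mod_cast hle n (n + 1 + 1) (by omega)
    · rcases le_or_gt i n with h | h
      · exact Or.inr ⟨i, hi, h, rfl⟩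
      · exact Or.inl ⟨by positivity, hle n i h⟩
  · refine ⟨1 / ((n : ℝ) + 3 / 2), Or.inl ⟨(hpos n).le, ?_⟩, ?_⟩
    · exact one_div_le_one_div_of_le (by positivity) (by linarith)
    · rintro (h | ⟨i, -, -, h⟩)
      · refine absurd h.2 (not_le.2 ?_)
        refine one_div_lt_one_div_of_lt (by positivity) ?_
        push_cast
        linarith
      · exact hgap n i h
  · have hK : ∃ᶠ x in nhdsWithin (0 : ℝ) (Ioi 0),
        x ∈ ({0} ∪ {x : ℝ | ∃ i : ℕ, 1 ≤ i ∧ x = 1 / (i : ℝ)} : Set ℝ) := by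
      refine (tendsto_nhdsWithin_iff.2 ⟨hlim, Eventually.of_forall fun n =>
        (by positivity : (0 : ℝ) < 1 / ((n : ℝ) + 1))⟩).frequently
        (Eventually.of_forall fun n => Or.inr ⟨n + 1, by omega, by push_cast; rfl⟩).frequently
    refine ⟨_, _, isDefiniteFilter_nhdsGT 0, isDefiniteFilter_nhdsGT 0, hK, hK, ?_, ?_⟩
    · suffices ht : Tendsto (fun n : ℕ => (1 : ℝ) / ((n : ℝ) + 3 / 2)) atTop (nhds 0) from
        (tendsto_nhdsWithin_iff.2 ⟨ht, Eventually.of_forall hpos⟩).frequently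
          (Eventually.of_forall hnot).frequently
      refine tendsto_of_tendsto_of_tendsto_of_le_of_le tendsto_const_nhds hlim
        (fun n => (hpos n).le) fun n => ?_
      exact one_div_le_one_div_of_le (by positivity) (by linarith)
    · intro U hU V _
      obtain ⟨u, hu, hs⟩ := mem_nhdsGT_iff_exists_Ioo_subset.1 hU
      obtain ⟨n, hn⟩ := exists_nat_one_div_lt (mem_Ioi.1 hu)
      refine ⟨n, ?_⟩
      rintro x (hx | ⟨i, hi, -, rfl⟩)
      · rcases hx.1.eq_or_lt with h | h
        · exact Or.inl (Or.inl (Or.inl h.symm))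
        · exact Or.inl (Or.inr (hs ⟨h, hx.2.trans_lt hn⟩))
      · exact Or.inl (Or.inl (Or.inr ⟨i, hi, rfl⟩))

theorem ApproximatedSet.isTameApproximation {K : Set ℝ} {L : ℕ → Set ℝ}
    (h : ApproximatedSet F K L) : IsTameApproximation F K L := by
  cases h with
  | right α β hle hlt hα hβ =>
    have := isTameApproximation_right (isTame_Icc (α 0) (β 0)) Icc_subset_Iic_self
      (fun i _ => hle i) hlt hα hβ
    convert! this using 1
    · ext x
      simp only [mem_union, mem_iUnion, exists_prop]
      constructor
      · rintro ⟨_ | i, hx⟩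
        exacts [Or.inl hx, Or.inr ⟨i + 1, by omega, hx⟩]
      · rintro (hx | ⟨i, -, hx⟩)
        exacts [⟨0, hx⟩, ⟨i, hx⟩]
    · funext n
      congr 1
      ext x
      simp only [mem_union, mem_iUnion, exists_prop]
      constructor
      · rintro ⟨_ | i, hi, hx⟩
        exacts [Or.inl hx, Or.inr ⟨i + 1, ⟨by omega, hi⟩, hx⟩]
      · rintro (hx | ⟨i, hi, hx⟩)
        exacts [⟨0, by omega, hx⟩, ⟨i, hi.2, hx⟩]
  | rightUnbounded α β hle hlt hα hβ =>
    exact isTameApproximation_right (isTame_Iic (β 0)) Subset.rfl hle hlt hα hβ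
  | left α β hle hlt hα hβ =>
    have := isTameApproximation_left (isTame_Icc (α 0) (β 0)) Icc_subset_Ici_self
      (fun i hi => hle i hi.le) hlt hα hβ
    convert! this using 1
    · ext x
      simp only [mem_union, mem_iUnion, exists_prop]
      constructor
      · rintro ⟨i, hi, hx⟩
        rcases hi.eq_or_lt with rfl | hi
        exacts [Or.inr hx, Or.inl ⟨i, hi, hx⟩]
      · rintro (⟨i, hi, hx⟩ | hx)
        exacts [⟨i, hi.le, hx⟩, ⟨0, le_rfl, hx⟩]
    · funext n
      ext x
      simp only [mem_union, mem_iUnion, exists_prop]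
      constructor
      · rintro (⟨i, hi, hx⟩ | hx)
        · rcases hi.2.eq_or_lt with rfl | h
          exacts [Or.inr hx, Or.inl (Or.inr ⟨i, ⟨hi.1, h⟩, hx⟩)]
        · exact Or.inl (Or.inl hx)
      · rintro ((hx | ⟨i, hi, hx⟩) | hx)
        exacts [Or.inr hx, Or.inl ⟨i, ⟨hi.1, hi.2.le⟩, hx⟩, Or.inl ⟨0, ⟨by omega, le_rfl⟩, hx⟩]
  | leftUnbounded α β hle hlt hα hβ =>
    exact isTameApproximation_left (isTame_Ici (α 0)) Subset.rfl hle hlt hα hβ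
  | twoSided α β hle hlt hαr hβr _ hβl =>
    exact isTameApproximation_twoSided hle hlt hαr hβr hβl
  | reciprocals => exact isTameApproximation_reciprocals

end Cases

theorem theorem7p3 (F : Subfield ℝ) (K : Set ℝ) (L : ℕ → Set ℝ) (h : ApproximatedSet F K L) :
    (∀ n, (naturalGenerators F (L n)).Finite ∧
      basicClosedSet F (naturalGenerators F (L n)) = L n) ∧
    posPoly F K = (⋃ n, posPoly F (L n)) ∧
    (⋃ n, posPoly F (L n)) = (⋃ n, genPreordering F (naturalGenerators F (L n))) ∧
    ¬ IsSemialgebraicSet K ∧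
    ¬ IsFinitelyGeneratedPreordering F (posPoly F K) := by
  have hL := h.isTameApproximation
  refine ⟨fun n => ⟨naturalGenerators_finite (hL.isTame n).finite_frontier,
    hL.basicClosedSet_eq n⟩, hL.posPoly_eq, iUnion_congr fun n => ?_, hL.not_isSemialgebraicSet,
    hL.not_isFinitelyGeneratedPreordering⟩
  exact (genPreordering_naturalGenerators (hL.isTame n).isClosed
    (hL.nonempty.mono (hL.subset n)) (hL.isTame n).frontier_subset).symm
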